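/- Consider the associativity system $a_t=b_x,\ b_t=c_x,\ c_t=(b^2-ac)_x$, i.e. $u_t=V(u)u_x$ for $u=(a,b,c)$ and $V=\begin{pmatrix}0&1&0\\0&0&1\\-c&2b&-a\end{pmatrix}$. Let $U\subset\mathbb R^3$ be an open set of the hodograph space $(a,b,c)$ on which $V$ has real, pairwise distinct eigenvalues (characteristic velocities) $v^1,v^2,v^3$ with left eigenvectors $l^1,l^2,l^3$, all chosen smoothly, and let $\omega^i=l^i_j\,du^j$. For a function $f$ write $df=\sum_j f_j\,\omega^j$. Then the following hold. 1. (Reciprocal invariants.) On $U$ the 1-forms $\Omega^i=\frac{v^i_i(v^j-v^k)}{(v^i-v^j)(v^i-v^k)}\,\omega^i$ ($(i,j,k)$ a cyclic permutation of $(1,2,3)$) and $\Omega=\sum_i\sum_{j\neq i}\frac{v^j_i-\frac12 v^i_i}{v^i-v^j}\,\omega^i$ are zero; hence also $d\Omega=0$. 2. (Reciprocal equivalence.) There are two conservation laws $B\,dx+A\,dt$ and $N\,dx+M\,dt$ of the system on $U$ (1-forms with coefficients smooth functions of $u$, closed along every solution) with $BM-AN\neq0$ and $M\,\mathrm{Id}-N\,V$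 invertible, such that the system $u_T=(BV-A\,\mathrm{Id})(M\,\mathrm{Id}-NV)^{-1}u_X$, obtained in the new variables $dX=B\,dx+A\,dt$, $dT=N\,dx+M\,dt$, has constant, pairwise distinct characteristic velocities, with the same eigenforms $\omega^i$. 3. (Hydrodynamic surfaces.) Let $S\subset U$ be a smooth surface on which the three characteristic distributions $\omega^i=0$ cut a 3-web, i.e. they meet each tangent plane of $S$ in three pairwise distinct lines. Then $S$ is a hydrodynamic surface (near each of its points it is parametrized by a solution $u(x,t)$ of the system) if and only if this 3-web is hexagonal. Here hexagonal means that the curvature $d\phi$ of the web is zero, where the connection form $\phi$ is determined by $d\phi^1=\phi\wedge\phi^1$, $d\phi^2=\phi\wedge\phi^2$, for 1-forms $\phi^1,\phi^2$ on $S$ such that the three families of curves are $\phi^1=0$, $\phi^2=0$, $\phi^1=\phi^2$. 4. (Twisted cubic.) Let $\gamma(\tau)=(-3\tau,-\tfrac32\tau^2,-\tau^3)$. For each $p\in U$ there are exactly three osculating planes of $\gamma$ through $p$, at the parameters $\tau=v^1(p),v^2(p),v^3(p)$. Let $\mathcal C$ be the set of all lines that lie in some osculating plane of $\gamma$ and are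 parallel to the tangent of $\gamma$ at the point where this plane osculates. Exactly three lines of $\mathcal C$ pass through $p$, namely the lines $\ell_i(p)$ through $p$ with direction $\gamma'(v^i(p))$. Within $U$ the line $\ell_i(p)$ is a rarefaction curve through $p$ of the $i$-th family (a curve whose velocity is at each point a right eigenvector of $V$ with eigenvalue $v^i$), and each rarefaction curve of the $i$-th family through $p$ is contained in $\ell_i(p)$. The plane $\omega^i=0$ at $p$ is spanned by the directions of the two other lines $\ell_j(p)$, $j\neq i$. Moreover, $\mathcal C$ is a congruence of order 3: taken over $\mathbb C$, precisely three lines of $\mathcal C$ pass through a generic point of $\mathbb C^3$. -/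

import Mathlib

open Set Matrix
open scoped ContDiff

noncomputable section

namespace Hydrodynamic

/-- The hodograph space with coordinates `(u⁰, u¹, u²)`; for the associativity system these are
`(a, b, c)`. -/
abbrev Hodograph : Type := Fin 3 → ℝ

/-- The plane: either the independent variables `(x, t)` or the parameters of a surface. -/
abbrev Plane : Type := ℝ × ℝ

/-! ### One-forms -/

section Forms

variable {X : Type*} [NormedAddCommGroup X] [NormedSpace ℝ X]

/-- The exterior derivative of the 1-form `α` at `p`, evaluated on the vectors `ξ, η`. -/
def extD (α : X → X →L[ℝ] ℝ) (p ξ η : X) : ℝ :=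
  fderiv ℝ α p ξ η - fderiv ℝ α p η ξ

/-- `extD` is Mathlib's exterior derivative, for 1-forms written as linear functionals. -/
theorem extD_eq_extDeriv (α : X → X →L[ℝ] ℝ) (p : X) (h : DifferentiableAt ℝ α p) (ξ η : X) :
    extD α p ξ η =
      extDeriv (fun q => ContinuousAlternatingMap.ofSubsingleton ℝ X ℝ (0 : Fin 1) (α q)) p
        ![ξ, η] := by
  have key : DifferentiableAt ℝ
      (fun q => ContinuousAlternatingMap.ofSubsingleton ℝ X ℝ (0 : Fin 1) (α q)) p :=
    ((ContinuousAlternatingMap.ofSubsingletonLIE (𝕜 := ℝ) (E := X) (F := ℝ)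
      (0 : Fin 1)).differentiableAt).comp p h
  have h1 : ∀ x : X, HasFDerivAt (fun q => α q x) ((fderiv ℝ α p).flip x) p := fun x => by
    simpa using h.hasFDerivAt.clm_apply (hasFDerivAt_const x p)
  rw [extDeriv_apply key]
  simp [extD, Fin.sum_univ_two, Fin.removeNth, (h1 ξ).fderiv, (h1 η).fderiv, sub_eq_add_neg]

/-- The exterior product of two linear functionals, evaluated on `ξ, η`. -/
def wedge (α β : X →L[ℝ] ℝ) (ξ η : X) : ℝ :=
  α ξ * β η - α η * β ξ

end Forms

/-- The covector `∑ⱼ lⱼ duʲ`. -/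
def covector (l : Hodograph) : Hodograph →L[ℝ] ℝ :=
  ∑ j, l j • (ContinuousLinearMap.proj j : Hodograph →L[ℝ] ℝ)

/-! ### Systems of hydrodynamic type -/

/-- `u : W → U` is a smooth solution of `u_t = V(u) u_x`; the points of the plane are `(x, t)`. -/
def IsSolution (V : Hodograph → Matrix (Fin 3) (Fin 3) ℝ) (W : Set Plane)
    (u : Plane → Hodograph) : Prop :=
  ContDiffOn ℝ ∞ u W ∧
    ∀ z ∈ W, fderiv ℝ u z (0, 1) = V (u z) *ᵥ fderiv ℝ u z (1, 0)

/-- On `U` the matrix `V(u)` has pairwise distinct real eigenvalues `v i u` (the characteristic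
velocities), with left eigenvectors `l i u`, all depending smoothly on `u`. -/
structure IsCharacteristicFrame (V : Hodograph → Matrix (Fin 3) (Fin 3) ℝ) (U : Set Hodograph)
    (v : Fin 3 → Hodograph → ℝ) (l : Fin 3 → Hodograph → Hodograph) : Prop where
  smooth_velocity : ∀ i, ContDiffOn ℝ ∞ (v i) U
  smooth_covector : ∀ i, ContDiffOn ℝ ∞ (l i) U
  distinct : ∀ u ∈ U, Function.Injective fun i => v i u
  ne_zero : ∀ u ∈ U, ∀ i, l i u ≠ 0
  left_eigen : ∀ u ∈ U, ∀ i, l i u ᵥ* V u = v i u • l i u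

/-- The eigenform `ωⁱ = lⁱⱼ duʲ`. -/
def eigenform (l : Fin 3 → Hodograph → Hodograph) (i : Fin 3) (u : Hodograph) :
    Hodograph →L[ℝ] ℝ :=
  covector (l i u)

/-- The coefficient `fⱼ` in the expansion `df = ∑ⱼ fⱼ ωʲ`, i.e. the derivative of `f` along the
`j`-th vector of the frame dual to `ω⁰, ω¹, ω²` (the `j`-th column of the inverse of the matrix
with rows `lⁱ`). -/
def frameDeriv (l : Fin 3 → Hodograph → Hodograph) (f : Hodograph → ℝ) (j : Fin 3)
    (u : Hodograph) : ℝ :=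
  fderiv ℝ f u fun k => (Matrix.of fun i => l i u)⁻¹ k j

theorem fderiv_eq_sum_frameDeriv (l : Fin 3 → Hodograph → Hodograph) (f : Hodograph → ℝ)
    (u : Hodograph) (h : IsUnit (Matrix.of fun i => l i u).det) :
    fderiv ℝ f u = ∑ j, frameDeriv l f j u • eigenform l j u := by
  set L : Matrix (Fin 3) (Fin 3) ℝ := Matrix.of fun i => l i u with hL
  ext x
  have hx : x = ∑ j, (L *ᵥ x) j • fun k => L⁻¹ k j := by
    have : x = L⁻¹ *ᵥ (L *ᵥ x) := by
      rw [Matrix.mulVec_mulVec, Matrix.nonsing_inv_mul _ h, Matrix.one_mulVec]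
    conv_lhs => rw [this]
    ext k
    simp [Matrix.mulVec, dotProduct, Finset.sum_apply, mul_comm]
  conv_lhs => rw [hx]
  rw [map_sum]
  simp only [map_smul, _root_.sum_apply, _root_.smul_apply, frameDeriv,
    eigenform, covector, smul_eq_mul, ContinuousLinearMap.proj_apply, Matrix.mulVec, dotProduct,
    hL, Matrix.of_apply]
  exact Finset.sum_congr rfl fun j _ => mul_comm _ _

/-! ### Reciprocal invariants -/

/-- The 1-forms `Ωⁱ = vⁱᵢ (vʲ - vᵏ) / ((vⁱ - vʲ)(vⁱ - vᵏ)) ωⁱ`, with `(i, j, k)` a cyclic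
permutation of the three indices. -/
def Omega_i (v : Fin 3 → Hodograph → ℝ) (l : Fin 3 → Hodograph → Hodograph) (i : Fin 3)
    (u : Hodograph) : Hodograph →L[ℝ] ℝ :=
  (frameDeriv l (v i) i u * (v (i + 1) u - v (i + 2) u) /
    ((v i u - v (i + 1) u) * (v i u - v (i + 2) u))) • eigenform l i u

/-- The 1-form `Ω = ∑ᵢ ∑_{j ≠ i} (vʲᵢ - ½ vⁱᵢ) / (vⁱ - vʲ) ωⁱ`. -/
def Omega (v : Fin 3 → Hodograph → ℝ) (l : Fin 3 → Hodograph → Hodograph)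
    (u : Hodograph) : Hodograph →L[ℝ] ℝ :=
  ∑ i, (∑ j ∈ Finset.univ.erase i,
    (frameDeriv l (v j) i u - frameDeriv l (v i) i u / 2) / (v i u - v j u)) • eigenform l i u

/-! ### Reciprocal transformations -/

/-- `B(u) dx + A(u) dt` is a conservation law on `U`: it is closed by virtue of
`u_t = V(u) u_x`. -/
def IsConservationLaw (V : Hodograph → Matrix (Fin 3) (Fin 3) ℝ) (U : Set Hodograph)
    (B A : Hodograph → ℝ) : Prop :=
  ContDiffOn ℝ ∞ B U ∧ ContDiffOn ℝ ∞ A U ∧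
    ∀ (W : Set Plane) (u : Plane → Hodograph), IsOpen W → MapsTo u W U → IsSolution V W u →
      ∀ z ∈ W, ∀ ξ η : Plane,
        extD (fun y => B (u y) • ContinuousLinearMap.fst ℝ ℝ ℝ +
          A (u y) • ContinuousLinearMap.snd ℝ ℝ ℝ) z ξ η = 0

/-- `dX = B dx + A dt`, `dT = N dx + M dt` is a reciprocal transformation of `u_t = V(u) u_x`
on `U`: both forms are conservation laws, they are independent, and the system can be solved for
`u_T`. -/
structure IsReciprocalTransformation (V : Hodograph → Matrix (Fin 3) (Fin 3) ℝ)
    (U : Set Hodograph) (B A N M : Hodograph → ℝ) : Prop where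
  law_X : IsConservationLaw V U B A
  law_T : IsConservationLaw V U N M
  independent : ∀ u ∈ U, B u * M u - A u * N u ≠ 0
  solvable : ∀ u ∈ U, IsUnit (M u • (1 : Matrix (Fin 3) (Fin 3) ℝ) - N u • V u)

/-- The matrix `(B V - A E)(M E - N V)⁻¹` of the system `u_T = V' u_X` which `u_t = V u_x` becomes
in the variables `X, T`. -/
def reciprocalMatrix (V : Hodograph → Matrix (Fin 3) (Fin 3) ℝ) (B A N M : Hodograph → ℝ)
    (u : Hodograph) : Matrix (Fin 3) (Fin 3) ℝ :=
  (B u • V u - A u • (1 : Matrix (Fin 3) (Fin 3) ℝ)) *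
    (M u • (1 : Matrix (Fin 3) (Fin 3) ℝ) - N u • V u)⁻¹

/-! ### Surfaces and their characteristic webs -/

/-- `r : W → S` is a smooth local parametrization of the set `S`: an injective immersion which is a
homeomorphism onto a relatively open part of `S`. -/
structure IsLocalParam (S : Set Hodograph) (W : Set Plane) (r : Plane → Hodograph) : Prop where
  isOpen : IsOpen W
  smooth : ContDiffOn ℝ ∞ r W
  immersion : ∀ w ∈ W, Function.Injective (fderiv ℝ r w)
  injOn : InjOn r W
  isOpen_image : ∀ W' ⊆ W, IsOpen W' → ∃ O : Set Hodograph, IsOpen O ∧ r '' W' = S ∩ O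

/-- `S` is a smooth (embedded) surface in the hodograph space. -/
def IsSmoothSurface (S : Set Hodograph) : Prop :=
  ∀ p ∈ S, ∃ (W : Set Plane) (r : Plane → Hodograph), IsLocalParam S W r ∧ p ∈ r '' W

/-- `S` is a hydrodynamic surface of `u_t = V(u) u_x`: near each of its points it is a solution
`u(x, t)`, viewed as a non-parametrized surface. -/
def IsHydrodynamicSurface (V : Hodograph → Matrix (Fin 3) (Fin 3) ℝ) (S : Set Hodograph) : Prop :=
  ∀ p ∈ S, ∃ (W : Set Plane) (r : Plane → Hodograph),
    IsLocalParam S W r ∧ p ∈ r '' W ∧ IsSolution V W r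

/-- The pull-back of the eigenform `ωⁱ` by `r`. -/
def pulledForm (l : Fin 3 → Hodograph → Hodograph) (r : Plane → Hodograph) (i : Fin 3)
    (w : Plane) : Plane →L[ℝ] ℝ :=
  (eigenform l i (r w)).comp (fderiv ℝ r w)

/-- The three distributions `ωⁱ = 0` cut a 3-web on `S`: at each point of `S` they meet the tangent
plane of `S` in three lines, which are pairwise distinct. -/
def CutsThreeWeb (l : Fin 3 → Hodograph → Hodograph) (S : Set Hodograph) : Prop :=
  ∀ (W : Set Plane) (r : Plane → Hodograph), IsLocalParam S W r →
    ∀ w ∈ W, ∀ i j, i ≠ j → LinearIndependent ℝ ![pulledForm l r i w, pulledForm l r j w]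

/-- `φ` is the connection form on `W` of the 3-web of curves `η⁰ = 0`, `η¹ = 0`, `η² = 0`, for the
normalization `φ₁, φ₂`: the three families are `φ₁ = 0`, `φ₂ = 0`, `φ₁ = φ₂`, and
`dφ₁ = φ ∧ φ₁`, `dφ₂ = φ ∧ φ₂`. -/
structure IsWebConnection (η : Fin 3 → Plane → Plane →L[ℝ] ℝ) (W : Set Plane)
    (φ₁ φ₂ φ : Plane → Plane →L[ℝ] ℝ) : Prop where
  smooth_one : ContDiffOn ℝ ∞ φ₁ W
  smooth_two : ContDiffOn ℝ ∞ φ₂ W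
  smooth_conn : ContDiffOn ℝ ∞ φ W
  first_family : ∀ w ∈ W, ∃ k : ℝ, k ≠ 0 ∧ φ₁ w = k • η 0 w
  second_family : ∀ w ∈ W, ∃ k : ℝ, k ≠ 0 ∧ φ₂ w = k • η 1 w
  third_family : ∀ w ∈ W, ∃ k : ℝ, k ≠ 0 ∧ φ₁ w - φ₂ w = k • η 2 w
  deriv_one : ∀ w ∈ W, ∀ ξ ζ, extD φ₁ w ξ ζ = wedge (φ w) (φ₁ w) ξ ζ
  deriv_two : ∀ w ∈ W, ∀ ξ ζ, extD φ₂ w ξ ζ = wedge (φ w) (φ₂ w) ξ ζ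

/-- The 3-web `η⁰ = 0`, `η¹ = 0`, `η² = 0` on `W` is hexagonal: its curvature form `dφ` vanishes.
(The curvature does not depend on the normalization.) -/
def IsHexagonalWeb (η : Fin 3 → Plane → Plane →L[ℝ] ℝ) (W : Set Plane) : Prop :=
  ∃ φ₁ φ₂ φ : Plane → Plane →L[ℝ] ℝ, IsWebConnection η W φ₁ φ₂ φ ∧
    ∀ w ∈ W, ∀ ξ ζ, extD φ w ξ ζ = 0

/-- The 3-web cut on `S` by the distributions `ωⁱ = 0` is hexagonal, in every local
parametrization of `S`. -/
def HasHexagonalWeb (l : Fin 3 → Hodograph → Hodograph) (S : Set Hodograph) : Prop :=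
  ∀ (W : Set Plane) (r : Plane → Hodograph), IsLocalParam S W r →
    IsHexagonalWeb (pulledForm l r) W

/-! ### Rarefaction curves -/

/-- `c : I → U` is a rarefaction curve of `u_t = V(u) u_x`, of the family with characteristic
velocity `v`: its velocity is a right eigenvector of `V` with eigenvalue `v`. -/
def IsRarefactionCurve (V : Hodograph → Matrix (Fin 3) (Fin 3) ℝ) (U : Set Hodograph)
    (v : Hodograph → ℝ) (I : Set ℝ) (c : ℝ → Hodograph) : Prop :=
  ∀ s ∈ I, c s ∈ U ∧ DifferentiableAt ℝ c s ∧ deriv c s ≠ 0 ∧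
    V (c s) *ᵥ deriv c s = v (c s) • deriv c s

/-! ### The associativity system -/

/-- The matrix of the system `a_t = b_x`, `b_t = c_x`, `c_t = (b² - ac)_x`. -/
def assocMatrix (u : Hodograph) : Matrix (Fin 3) (Fin 3) ℝ :=
  !![0, 1, 0; 0, 0, 1; -u 2, 2 * u 1, -u 0]

/-- Solutions of the system with matrix `assocMatrix` are those of `a_t = b_x`, `b_t = c_x`,
`c_t = (b² - ac)_x`. -/
theorem isSolution_assocMatrix_iff {W : Set Plane} (hW : IsOpen W) (u : Plane → Hodograph) :
    IsSolution assocMatrix W u ↔ ContDiffOn ℝ ∞ u W ∧ ∀ z ∈ W,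
      fderiv ℝ (fun y => u y 0) z (0, 1) = fderiv ℝ (fun y => u y 1) z (1, 0) ∧
      fderiv ℝ (fun y => u y 1) z (0, 1) = fderiv ℝ (fun y => u y 2) z (1, 0) ∧
      fderiv ℝ (fun y => u y 2) z (0, 1) =
        fderiv ℝ (fun y => u y 1 ^ 2 - u y 0 * u y 2) z (1, 0) := by
  refine and_congr_right fun hu => forall₂_congr fun z hz => ?_
  have hd : DifferentiableAt ℝ u z :=
    (hu.contDiffAt (hW.mem_nhds hz)).differentiableAt (by simp)
  have hi : ∀ i, HasFDerivAt (fun y => u y i)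
      ((ContinuousLinearMap.proj i : Hodograph →L[ℝ] ℝ).comp (fderiv ℝ u z)) z := fun i =>
    (ContinuousLinearMap.proj i : Hodograph →L[ℝ] ℝ).hasFDerivAt.comp z hd.hasFDerivAt
  have hq := ((hi 1).pow 2).sub ((hi 0).mul (hi 2))
  have hq' : fderiv ℝ (fun y => u y 1 ^ 2 - u y 0 * u y 2) z = _ := hq.fderiv
  rw [(hi 0).fderiv, (hi 1).fderiv, (hi 2).fderiv, hq']
  rw [funext_iff, Fin.forall_fin_succ, Fin.forall_fin_succ, Fin.forall_fin_succ]
  simp only [assocMatrix, Matrix.mulVec, dotProduct, Fin.sum_univ_three]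
  simp
  intro _ _
  constructor <;> intro h <;> rw [h] <;> ring

/-! ### The twisted cubic and its congruence of lines -/

section Cubic

variable (𝕜 : Type*) [RCLike 𝕜]

/-- The twisted cubic `a = -3τ`, `b = -3τ²/2`, `c = -τ³`. -/
def cubic (τ : 𝕜) : Fin 3 → 𝕜 :=
  ![-3 * τ, -3 * τ ^ 2 / 2, -τ ^ 3]

/-- The osculating plane of the twisted cubic at the parameter `τ`. -/
def oscPlane (τ : 𝕜) : AffineSubspace 𝕜 (Fin 3 → 𝕜) :=
  AffineSubspace.mk' (cubic 𝕜 τ)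
    (Submodule.span 𝕜 {deriv (cubic 𝕜) τ, deriv (deriv (cubic 𝕜)) τ})

/-- The line through `p` parallel to the tangent of the twisted cubic at the parameter `τ`. -/
def tangentialLine (p : Fin 3 → 𝕜) (τ : 𝕜) : AffineSubspace 𝕜 (Fin 3 → 𝕜) :=
  AffineSubspace.mk' p (Submodule.span 𝕜 {deriv (cubic 𝕜) τ})

/-- The congruence of all lines which lie in some osculating plane of the twisted cubic and are
parallel to its tangent at the point of osculation. -/
def cubicCongruence : Set (AffineSubspace 𝕜 (Fin 3 → 𝕜)) :=
  {ℓ | ∃ τ, ∃ p ∈ oscPlane 𝕜 τ, ℓ = tangentialLine 𝕜 p τ}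

end Cubic

/-- A family of lines in complex 3-space has order `n`: through a generic point (off the zero set
of a nonzero polynomial) there pass precisely `n` of its lines. -/
def HasOrder (C : Set (AffineSubspace ℂ (Fin 3 → ℂ))) (n : ℕ) : Prop :=
  ∃ Q : MvPolynomial (Fin 3) ℂ, Q ≠ 0 ∧
    ∀ p : Fin 3 → ℂ, MvPolynomial.eval p Q ≠ 0 →
      {ℓ | ℓ ∈ C ∧ p ∈ ℓ}.Finite ∧ {ℓ | ℓ ∈ C ∧ p ∈ ℓ}.ncard = n

end Hydrodynamic

end

open Hydrodynamic

namespace Hydrodynamic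

/-! The matrix `assocMatrix` is a companion matrix with characteristic polynomial τ³ + aτ² − 2bτ +
c. Hence a, b, c are symmetric functions of the velocities, the right eigenvectors are eᵢ = (1, vⁱ,
(vⁱ)²), and ωⁱ is, up to a factor, the functional taking (1, x, x²) to (x − vʲ)(x − vᵏ). For fixed τ
the polynomial is affine in (a, b, c) and its zero plane is the osculating plane of the cubic at τ,
while γ'(vⁱ) = −3eᵢ; this is the link with the twisted cubic. Implicit differentiation
(`fderiv_velocity`) gives zero for the derivative of vⁱ along eᵢ and −(vʲ − vⁱ)/(vʲ − vᵏ) for that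
of vʲ. So the reciprocal invariants vanish and the rarefaction curves are straight.

The reciprocal transformation and the hydrodynamic surfaces both rest on the conservation laws βᵢ =
(vʲ − vᵏ)(dx + vⁱ dt), with (i, j, k) cyclic (`fderiv_flux`), whose sum is identically zero. Taking
dX = β₀ + β₁ and dT = β₀ − β₁ makes the velocities 1, −1, 0.

On a solution βᵢ is proportional to the restriction of ωⁱ, so the characteristic web is defined by
closed forms with zero sum. Locally this is the same as hexagonality: in terms of a web connection
β₀ = aφ₁ and β₁ = −aφ₂, and closedness means φ = −d log|a| (`IsWebConnection.extD_eq_zero`,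
`IsHexagonalWeb.exists_closedTriple`). Conversely, closed forms of this kind on a surface can be
written (vʲ − vᵏ)(θ + vⁱψ). The identity behind the conservation laws then forces dθ = dψ = 0
(`IsClosedTriple.coframe_closed`), and local primitives x of θ and t of ψ are coordinates in which
the surface is a solution (`IsClosedTriple.exists_solution`). -/

/-- The right eigenvector `(1, x, x²)` of `assocMatrix` for the eigenvalue `x`. -/
def eigenvector (x : ℝ) : Hodograph := ![1, x, x ^ 2]

/-- Divided differences: subtracting two equations and cancelling the difference of the roots lowers
the degree, and doing it twice isolates a. -/
theorem vieta_of_roots {a b c x y z : ℝ} (hxy : x ≠ y) (hxz : x ≠ z) (hyz : y ≠ z)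
    (hx : x ^ 3 + a * x ^ 2 - 2 * b * x + c = 0) (hy : y ^ 3 + a * y ^ 2 - 2 * b * y + c = 0)
    (hz : z ^ 3 + a * z ^ 2 - 2 * b * z + c = 0) :
    a = -(x + y + z) ∧ b = -(x * y + x * z + y * z) / 2 ∧ c = -(x * y * z) := by
  have h1 : x ^ 2 + x * y + y ^ 2 + a * (x + y) - 2 * b = 0 :=
    mul_left_cancel₀ (sub_ne_zero.2 hxy) (by linear_combination hx - hy)
  have h2 : x ^ 2 + x * z + z ^ 2 + a * (x + z) - 2 * b = 0 :=
    mul_left_cancel₀ (sub_ne_zero.2 hxz) (by linear_combination hx - hz)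
  have h3 : a = -(x + y + z) := by
    have : x + y + z + a = 0 :=
      mul_left_cancel₀ (sub_ne_zero.2 hyz) (by linear_combination h1 - h2)
    linarith
  have h4 : b = -(x * y + x * z + y * z) / 2 := by
    subst h3; linarith
  refine ⟨h3, h4, ?_⟩
  subst h3 h4
  linear_combination hx

/-! ### Eigenvectors, eigenforms and derivatives of the characteristic velocities. -/

section Frame

variable {U : Set Hodograph} {v : Fin 3 → Hodograph → ℝ} {l : Fin 3 → Hodograph → Hodograph}

theorem Fin.add_one_ne (i : Fin 3) : i ≠ i + 1 := by revert i; decide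

theorem Fin.add_two_ne (i : Fin 3) : i ≠ i + 2 := by revert i; decide

theorem Fin.add_one_ne_add_two (i : Fin 3) : i + 1 ≠ i + 2 := by revert i; decide

theorem Fin.add_one_add_one (i : Fin 3) : i + 1 + 1 = i + 2 := by revert i; decide

theorem Fin.add_one_add_two (i : Fin 3) : i + 1 + 2 = i := by revert i; decide

theorem Fin.add_two_add_one (i : Fin 3) : i + 2 + 1 = i := by revert i; decide

theorem Fin.add_two_add_two (i : Fin 3) : i + 2 + 2 = i + 1 := by revert i; decide

theorem Fin.eq_or_eq_add (i j : Fin 3) : j = i ∨ j = i + 1 ∨ j = i + 2 := by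
  revert i j; decide

theorem IsCharacteristicFrame.ne (h : IsCharacteristicFrame assocMatrix U v l) {u : Hodograph}
    (hu : u ∈ U) {i j : Fin 3} (hij : i ≠ j) : v i u ≠ v j u :=
  fun e => hij (h.distinct u hu e)

/-- The last two columns of the left eigenvector equation express the covector through its last
entry; the first column then becomes the characteristic equation. -/
theorem IsCharacteristicFrame.covector_eq (h : IsCharacteristicFrame assocMatrix U v l)
    {u : Hodograph} (hu : u ∈ U) (i : Fin 3) :
    l i u 1 = l i u 2 * (v i u + u 0) ∧ l i u 0 = l i u 2 * (v i u ^ 2 + u 0 * v i u - 2 * u 1) ∧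
      l i u 2 * (v i u ^ 3 + u 0 * v i u ^ 2 - 2 * u 1 * v i u + u 2) = 0 := by
  have e := h.left_eigen u hu i
  have e0 := congrFun e 0
  have e1 := congrFun e 1
  have e2 := congrFun e 2
  simp [assocMatrix, Matrix.vecMul, dotProduct, Fin.sum_univ_three] at e0 e1 e2
  have h1 : l i u 1 = l i u 2 * (v i u + u 0) := by linarith
  have h0 : l i u 0 = l i u 2 * (v i u ^ 2 + u 0 * v i u - 2 * u 1) := by
    rw [h1] at e1; linarith
  refine ⟨h1, h0, ?_⟩
  rw [h0] at e0
  linarith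

theorem IsCharacteristicFrame.covector_two_ne (h : IsCharacteristicFrame assocMatrix U v l)
    {u : Hodograph} (hu : u ∈ U) (i : Fin 3) : l i u 2 ≠ 0 := by
  intro h2
  obtain ⟨h1, h0, -⟩ := h.covector_eq hu i
  refine h.ne_zero u hu i ?_
  ext k
  fin_cases k <;> simp [h0, h1, h2]

theorem IsCharacteristicFrame.root (h : IsCharacteristicFrame assocMatrix U v l)
    {u : Hodograph} (hu : u ∈ U) (i : Fin 3) :
    v i u ^ 3 + u 0 * v i u ^ 2 - 2 * u 1 * v i u + u 2 = 0 :=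
  (mul_eq_zero.1 (h.covector_eq hu i).2.2).resolve_left (h.covector_two_ne hu i)

theorem IsCharacteristicFrame.vieta (h : IsCharacteristicFrame assocMatrix U v l)
    {u : Hodograph} (hu : u ∈ U) (i : Fin 3) :
    u 0 = -(v i u + v (i + 1) u + v (i + 2) u) ∧
    u 1 = -(v i u * v (i + 1) u + v i u * v (i + 2) u + v (i + 1) u * v (i + 2) u) / 2 ∧
    u 2 = -(v i u * v (i + 1) u * v (i + 2) u) :=
  vieta_of_roots (h.ne hu (Fin.add_one_ne i)) (h.ne hu (Fin.add_two_ne i))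
    (h.ne hu (Fin.add_one_ne_add_two i)) (h.root hu i) (h.root hu _) (h.root hu _)

theorem IsCharacteristicFrame.exists_eq_of_root (h : IsCharacteristicFrame assocMatrix U v l)
    {u : Hodograph} (hu : u ∈ U) {x : ℝ} (hx : x ^ 3 + u 0 * x ^ 2 - 2 * u 1 * x + u 2 = 0) :
    ∃ i, v i u = x := by
  obtain ⟨h0, h1, h2⟩ := h.vieta hu 0
  have : (x - v 0 u) * ((x - v (0 + 1) u) * (x - v (0 + 2) u)) = 0 := by
    rw [h0, h1, h2] at hx
    linear_combination hx
  rcases mul_eq_zero.1 this with e | e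
  · exact ⟨0, (sub_eq_zero.1 e).symm⟩
  · rcases mul_eq_zero.1 e with e | e
    · exact ⟨_, (sub_eq_zero.1 e).symm⟩
    · exact ⟨_, (sub_eq_zero.1 e).symm⟩

theorem eigenform_apply (i : Fin 3) (u ξ : Hodograph) :
    eigenform l i u ξ = l i u 0 * ξ 0 + l i u 1 * ξ 1 + l i u 2 * ξ 2 := by
  simp [eigenform, covector, Fin.sum_univ_three]

/-- By Vieta the quotient of the characteristic polynomial by x − vⁱ is (x − vⁱ⁺¹)(x − vⁱ⁺²). The
eigenform is this quotient with 1, x, x² replaced by the coordinates of ξ, which yields the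
biorthogonality with the vectors (1, x, x²). -/
theorem IsCharacteristicFrame.eigenform_apply_eq (h : IsCharacteristicFrame assocMatrix U v l)
    {u : Hodograph} (hu : u ∈ U) (i : Fin 3) (ξ : Hodograph) :
    eigenform l i u ξ = l i u 2 *
      (v (i + 1) u * v (i + 2) u * ξ 0 - (v (i + 1) u + v (i + 2) u) * ξ 1 + ξ 2) := by
  obtain ⟨e1, e0, -⟩ := h.covector_eq hu i
  obtain ⟨h0, h1, h2⟩ := h.vieta hu i
  rw [eigenform_apply, e0, e1, h0, h1]
  ring

theorem IsCharacteristicFrame.eigenform_eigenvector_self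
    (h : IsCharacteristicFrame assocMatrix U v l) {u : Hodograph} (hu : u ∈ U) (i : Fin 3) :
    eigenform l i u (eigenvector (v i u)) =
      l i u 2 * ((v i u - v (i + 1) u) * (v i u - v (i + 2) u)) := by
  rw [h.eigenform_apply_eq hu]
  simp [eigenvector]
  left; ring

theorem IsCharacteristicFrame.eigenform_eigenvector_self_ne
    (h : IsCharacteristicFrame assocMatrix U v l) {u : Hodograph} (hu : u ∈ U) (i : Fin 3) :
    eigenform l i u (eigenvector (v i u)) ≠ 0 := by
  rw [h.eigenform_eigenvector_self hu]
  exact mul_ne_zero (h.covector_two_ne hu i) (mul_ne_zero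
    (sub_ne_zero.2 (h.ne hu (Fin.add_one_ne i))) (sub_ne_zero.2 (h.ne hu (Fin.add_two_ne i))))

theorem IsCharacteristicFrame.eigenform_eigenvector_of_ne
    (h : IsCharacteristicFrame assocMatrix U v l) {u : Hodograph} (hu : u ∈ U) {i j : Fin 3}
    (hij : j ≠ i) : eigenform l i u (eigenvector (v j u)) = 0 := by
  rw [h.eigenform_apply_eq hu]
  rcases Fin.eq_or_eq_add i j with rfl | rfl | rfl
  · exact absurd rfl hij
  all_goals simp [eigenvector]; right; ring

/-- The vectors are determined by the values of the eigenforms. -/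
theorem IsCharacteristicFrame.eq_of_eigenform_eq
    (h : IsCharacteristicFrame assocMatrix U v l) {u : Hodograph} (hu : u ∈ U) {ξ η : Hodograph}
    (e : ∀ i, eigenform l i u ξ = eigenform l i u η) : ξ = η := by
  have key : ∀ i, v (i + 1) u * v (i + 2) u * (ξ 0 - η 0) - (v (i + 1) u + v (i + 2) u) *
      (ξ 1 - η 1) + (ξ 2 - η 2) = 0 := fun i => by
    have := e i
    rw [h.eigenform_apply_eq hu, h.eigenform_apply_eq hu] at this
    linear_combination mul_left_cancel₀ (h.covector_two_ne hu i) this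
  have k0 := key 0
  have k1 := key 1
  have k2 := key 2
  have d01 := sub_ne_zero.2 (h.ne hu (show (0 : Fin 3) ≠ 1 by decide))
  have d02 := sub_ne_zero.2 (h.ne hu (show (0 : Fin 3) ≠ 2 by decide))
  have d12 := sub_ne_zero.2 (h.ne hu (show (1 : Fin 3) ≠ 2 by decide))
  rw [show (0 : Fin 3) + 1 = 1 from rfl, show (0 : Fin 3) + 2 = 2 from rfl] at k0
  rw [show (1 : Fin 3) + 1 = 2 from rfl, show (1 : Fin 3) + 2 = 0 from rfl] at k1
  rw [show (2 : Fin 3) + 1 = 0 from rfl, show (2 : Fin 3) + 2 = 1 from rfl] at k2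
  have a1 : v 2 u * (ξ 0 - η 0) - (ξ 1 - η 1) = 0 :=
    mul_left_cancel₀ d01 (by linear_combination k1 - k0)
  have a2 : v 1 u * (ξ 0 - η 0) - (ξ 1 - η 1) = 0 :=
    mul_left_cancel₀ d02 (by linear_combination k2 - k0)
  have a3 : ξ 0 - η 0 = 0 := mul_left_cancel₀ d12 (by linear_combination a2 - a1)
  have a4 : ξ 1 - η 1 = 0 := by rw [a3] at a1; linarith
  have a5 : ξ 2 - η 2 = 0 := by rw [a3, a4] at k0; linarith
  ext k
  fin_cases k
  exacts [sub_eq_zero.1 a3, sub_eq_zero.1 a4, sub_eq_zero.1 a5]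

theorem IsCharacteristicFrame.eigenform_mulVec
    (h : IsCharacteristicFrame assocMatrix U v l) {u : Hodograph} (hu : u ∈ U) (i : Fin 3)
    (ξ : Hodograph) : eigenform l i u (assocMatrix u *ᵥ ξ) = v i u * eigenform l i u ξ := by
  have hd : ∀ η, eigenform l i u η = l i u ⬝ᵥ η := fun η => by
    rw [eigenform_apply]; simp [dotProduct, Fin.sum_univ_three]
  rw [hd, hd, Matrix.dotProduct_mulVec, h.left_eigen u hu i, smul_dotProduct, smul_eq_mul]

/-- Biorthogonality: the frame dual to the eigenforms consists of the right eigenvectors, rescaled.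
Frame derivatives are thereby derivatives along (1, vʲ, (vʲ)²). -/
theorem IsCharacteristicFrame.inverse_column
    (h : IsCharacteristicFrame assocMatrix U v l) {u : Hodograph} (hu : u ∈ U) (j : Fin 3) :
    (fun k => (Matrix.of fun i => l i u)⁻¹ k j) =
      (eigenform l j u (eigenvector (v j u)))⁻¹ • eigenvector (v j u) := by
  set L : Matrix (Fin 3) (Fin 3) ℝ := Matrix.of fun i => l i u with hL
  have hLi : ∀ i (η : Hodograph), (L *ᵥ η) i = eigenform l i u η := fun i η => by
    rw [eigenform_apply]; simp [hL, Matrix.mulVec, dotProduct, Fin.sum_univ_three]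
  have hdet : IsUnit L.det := by
    rw [← Matrix.isUnit_iff_isUnit_det, ← Matrix.mulVec_injective_iff_isUnit]
    intro ξ η e
    exact h.eq_of_eigenform_eq hu fun i => by rw [← hLi, ← hLi, e]
  have hc : L *ᵥ ((eigenform l j u (eigenvector (v j u)))⁻¹ • eigenvector (v j u)) =
      Pi.single j 1 := by
    ext i
    rw [hLi, map_smul, smul_eq_mul]
    rcases eq_or_ne i j with rfl | hij
    · rw [inv_mul_cancel₀ (h.eigenform_eigenvector_self_ne hu _), Pi.single_eq_same]
    · rw [h.eigenform_eigenvector_of_ne hu hij.symm, mul_zero, Pi.single_eq_of_ne hij]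
  have : L⁻¹ *ᵥ Pi.single j 1 =
      (eigenform l j u (eigenvector (v j u)))⁻¹ • eigenvector (v j u) := by
    rw [← hc, Matrix.mulVec_mulVec, Matrix.nonsing_inv_mul _ hdet, Matrix.one_mulVec]
  rw [← this]
  ext k
  simp

theorem IsCharacteristicFrame.frameDeriv_eq
    (h : IsCharacteristicFrame assocMatrix U v l) {u : Hodograph} (hu : u ∈ U)
    (f : Hodograph → ℝ) (j : Fin 3) :
    frameDeriv l f j u =
      (eigenform l j u (eigenvector (v j u)))⁻¹ * fderiv ℝ f u (eigenvector (v j u)) := by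
  rw [frameDeriv, h.inverse_column hu, map_smul, smul_eq_mul]

theorem IsCharacteristicFrame.differentiableAt (hU : IsOpen U)
    (h : IsCharacteristicFrame assocMatrix U v l) {u : Hodograph} (hu : u ∈ U) (i : Fin 3) :
    DifferentiableAt ℝ (v i) u :=
  ((h.smooth_velocity i).contDiffAt (hU.mem_nhds hu)).differentiableAt (by simp)

/-- Implicit differentiation of the characteristic equation; the denominator is the derivative of
the polynomial at its root vⁱ. For ξ = (1, x, x²) the numerator is −(vⁱ − x)². -/
theorem IsCharacteristicFrame.fderiv_velocity (hU : IsOpen U)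
    (h : IsCharacteristicFrame assocMatrix U v l) {u : Hodograph} (hu : u ∈ U) (i : Fin 3)
    (ξ : Hodograph) :
    fderiv ℝ (v i) u ξ = -(v i u ^ 2 * ξ 0 - 2 * v i u * ξ 1 + ξ 2) /
      ((v i u - v (i + 1) u) * (v i u - v (i + 2) u)) := by
  have hv := (h.differentiableAt hU hu i).hasFDerivAt
  have hp : ∀ k, HasFDerivAt (fun y : Hodograph => y k)
      (ContinuousLinearMap.proj k : Hodograph →L[ℝ] ℝ) u := fun k =>
    (ContinuousLinearMap.proj k : Hodograph →L[ℝ] ℝ).hasFDerivAt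
  have hF := (((hv.pow 3).add ((hp 0).mul (hv.pow 2))).sub
    (((hp 1).const_mul 2).mul hv)).add (hp 2)
  have hz : HasFDerivAt (fun y : Hodograph =>
      v i y ^ 3 + y 0 * v i y ^ 2 - 2 * y 1 * v i y + y 2) (0 : Hodograph →L[ℝ] ℝ) u :=
    (hasFDerivAt_const (0 : ℝ) u).congr_of_eventuallyEq <| by
      filter_upwards [hU.mem_nhds hu] with y hy using h.root hy i
  have e := DFunLike.congr_fun (hF.unique hz) ξ
  simp at e
  obtain ⟨h0, h1, h2⟩ := h.vieta hu i
  rw [h0, h1] at e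
  have d1 := sub_ne_zero.2 (h.ne hu (Fin.add_one_ne i))
  have d2 := sub_ne_zero.2 (h.ne hu (Fin.add_two_ne i))
  rw [eq_div_iff (mul_ne_zero d1 d2)]
  linear_combination e

end Frame

/-! ### Vanishing of the reciprocal invariants. -/

section Invariants

variable {U : Set Hodograph} {v : Fin 3 → Hodograph → ℝ} {l : Fin 3 → Hodograph → Hodograph}

theorem IsCharacteristicFrame.fderiv_velocity_eigenvector_self (hU : IsOpen U)
    (h : IsCharacteristicFrame assocMatrix U v l) {u : Hodograph} (hu : u ∈ U) (i : Fin 3) :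
    fderiv ℝ (v i) u (eigenvector (v i u)) = 0 := by
  rw [h.fderiv_velocity hU hu]
  simp [eigenvector]
  left; ring

/-- All characteristic velocities are linearly degenerate. -/
theorem IsCharacteristicFrame.frameDeriv_velocity_self (hU : IsOpen U)
    (h : IsCharacteristicFrame assocMatrix U v l) {u : Hodograph} (hu : u ∈ U) (i : Fin 3) :
    frameDeriv l (v i) i u = 0 := by
  rw [h.frameDeriv_eq hu, h.fderiv_velocity_eigenvector_self hU hu, mul_zero]

theorem IsCharacteristicFrame.Omega_i_eq_zero (hU : IsOpen U)
    (h : IsCharacteristicFrame assocMatrix U v l) {u : Hodograph} (hu : u ∈ U) (i : Fin 3) :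
    Omega_i v l i u = 0 := by
  rw [Omega_i, h.frameDeriv_velocity_self hU hu]
  simp

/-- Since vⁱᵢ = 0, the coefficient of ωⁱ is, up to the normalization of the dual vector, 1/(vʲ − vᵏ)
+ 1/(vᵏ − vʲ) = 0. -/
theorem IsCharacteristicFrame.Omega_eq_zero (hU : IsOpen U)
    (h : IsCharacteristicFrame assocMatrix U v l) {u : Hodograph} (hu : u ∈ U) :
    Omega v l u = 0 := by
  refine Finset.sum_eq_zero fun i _ => ?_
  have he : (Finset.univ.erase i : Finset (Fin 3)) = {i + 1, i + 2} := by
    revert i; decide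
  rw [he, Finset.sum_pair (Fin.add_one_ne_add_two i), h.frameDeriv_velocity_self hU hu,
    h.frameDeriv_eq hu, h.frameDeriv_eq hu, h.fderiv_velocity hU hu, h.fderiv_velocity hU hu]
  rw [Fin.add_one_add_one, Fin.add_one_add_two, Fin.add_two_add_one, Fin.add_two_add_two]
  have d1 := sub_ne_zero.2 (h.ne hu (Fin.add_one_ne i))
  have d2 := sub_ne_zero.2 (h.ne hu (Fin.add_two_ne i))
  have d3 := sub_ne_zero.2 (h.ne hu (Fin.add_one_ne_add_two i))
  have d1' := sub_ne_zero.2 (h.ne hu (Fin.add_one_ne i).symm)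
  have d2' := sub_ne_zero.2 (h.ne hu (Fin.add_two_ne i).symm)
  have d3' := sub_ne_zero.2 (h.ne hu (Fin.add_one_ne_add_two i).symm)
  have d0 := h.eigenform_eigenvector_self_ne hu i
  convert zero_smul ℝ _
  simp only [eigenvector, Matrix.cons_val_zero, Matrix.cons_val_one, Matrix.cons_val]
  simp only [eigenvector] at d0
  field_simp
  ring

theorem IsCharacteristicFrame.extD_Omega_eq_zero (hU : IsOpen U)
    (h : IsCharacteristicFrame assocMatrix U v l) {u : Hodograph} (hu : u ∈ U)
    (ξ η : Hodograph) : extD (Omega v l) u ξ η = 0 := by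
  have : fderiv ℝ (Omega v l) u = 0 := by
    refine HasFDerivAt.fderiv ((hasFDerivAt_const (0 : Hodograph →L[ℝ] ℝ) u).congr_of_eventuallyEq
      ?_)
    filter_upwards [hU.mem_nhds hu] with y hy using h.Omega_eq_zero hU hy
  simp [extD, this]

end Invariants

/-! ### Three conservation laws and the reduction to constant velocities. -/

section Reciprocal

variable {U : Set Hodograph} {v : Fin 3 → Hodograph → ℝ} {l : Fin 3 → Hodograph → Hodograph}

/-- The densities `vⁱ⁺¹ - vⁱ⁺²` of the conservation laws `(vⁱ⁺¹ - vⁱ⁺²)(dx + vⁱ dt)`. -/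
def density (v : Fin 3 → Hodograph → ℝ) (i : Fin 3) (u : Hodograph) : ℝ :=
  v (i + 1) u - v (i + 2) u

/-- The fluxes `vⁱ (vⁱ⁺¹ - vⁱ⁺²)` of the conservation laws `(vⁱ⁺¹ - vⁱ⁺²)(dx + vⁱ dt)`. -/
def flux (v : Fin 3 → Hodograph → ℝ) (i : Fin 3) (u : Hodograph) : ℝ :=
  density v i u * v i u

theorem IsCharacteristicFrame.contDiffOn_density (h : IsCharacteristicFrame assocMatrix U v l)
    (i : Fin 3) : ContDiffOn ℝ ∞ (density v i) U :=
  (h.smooth_velocity _).sub (h.smooth_velocity _)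

theorem IsCharacteristicFrame.contDiffOn_flux (h : IsCharacteristicFrame assocMatrix U v l)
    (i : Fin 3) : ContDiffOn ℝ ∞ (flux v i) U :=
  (h.contDiffOn_density i).mul (h.smooth_velocity i)

theorem IsCharacteristicFrame.density_ne_zero (h : IsCharacteristicFrame assocMatrix U v l)
    {u : Hodograph} (hu : u ∈ U) (i : Fin 3) : density v i u ≠ 0 :=
  sub_ne_zero.2 (h.ne hu (Fin.add_one_ne_add_two i))

/-- Substituting Vieta's formulas and the explicit derivatives of the velocities leaves a rational
identity in the three velocities, linear in ξ. It gives the conservation laws, and later the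
closedness of the coframe on a surface. -/
theorem IsCharacteristicFrame.fderiv_flux (hU : IsOpen U)
    (h : IsCharacteristicFrame assocMatrix U v l) {u : Hodograph} (hu : u ∈ U) (i : Fin 3)
    (ξ : Hodograph) :
    fderiv ℝ (flux v i) u ξ = fderiv ℝ (density v i) u (assocMatrix u *ᵥ ξ) := by
  have hd : ∀ j, HasFDerivAt (v j) (fderiv ℝ (v j) u) u := fun j =>
    (h.differentiableAt hU hu j).hasFDerivAt
  have hD : HasFDerivAt (density v i) _ u := (hd (i + 1)).sub (hd (i + 2))
  have hF : HasFDerivAt (flux v i) _ u := hD.mul (hd i)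
  rw [hF.fderiv, hD.fderiv]
  simp only [_root_.add_apply, _root_.smul_apply, _root_.sub_apply, smul_eq_mul,
    h.fderiv_velocity hU hu, density]
  rw [Fin.add_one_add_one, Fin.add_one_add_two, Fin.add_two_add_one, Fin.add_two_add_two]
  obtain ⟨h0, h1, h2⟩ := h.vieta hu i
  have m0 : (assocMatrix u *ᵥ ξ) 0 = ξ 1 := by
    simp [assocMatrix, Matrix.mulVec, dotProduct, Fin.sum_univ_three]
  have m1 : (assocMatrix u *ᵥ ξ) 1 = ξ 2 := by
    simp [assocMatrix, Matrix.mulVec, dotProduct, Fin.sum_univ_three]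
  have m2 : (assocMatrix u *ᵥ ξ) 2 = -u 2 * ξ 0 + 2 * u 1 * ξ 1 - u 0 * ξ 2 := by
    simp [assocMatrix, Matrix.mulVec, dotProduct, Fin.sum_univ_three]; ring
  rw [m0, m1, m2, h0, h1, h2]
  have d1 := sub_ne_zero.2 (h.ne hu (Fin.add_one_ne i))
  have d2 := sub_ne_zero.2 (h.ne hu (Fin.add_two_ne i))
  have d3 := sub_ne_zero.2 (h.ne hu (Fin.add_one_ne_add_two i))
  have d1' := sub_ne_zero.2 (h.ne hu (Fin.add_one_ne i).symm)
  have d2' := sub_ne_zero.2 (h.ne hu (Fin.add_two_ne i).symm)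
  have d3' := sub_ne_zero.2 (h.ne hu (Fin.add_one_ne_add_two i).symm)
  generalize v i u = x at *
  generalize v (i + 1) u = y at *
  generalize v (i + 2) u = z at *
  generalize ξ 0 = a
  generalize ξ 1 = b
  generalize ξ 2 = c
  -- Gives each difference a single orientation, so that clearing denominators recognizes equal
  -- factors.
  rw [← neg_sub x y, ← neg_sub x z, ← neg_sub y z]
  field_simp
  ring

/-- On a solution the exterior derivative of B dx + A dt has the coefficient A_x − B_t = dA(u_x) −
dB(V u_x). -/
theorem isConservationLaw_of_fderiv {V : Hodograph → Matrix (Fin 3) (Fin 3) ℝ}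
    {B A : Hodograph → ℝ} (hU : IsOpen U)
    (hB : ContDiffOn ℝ ∞ B U) (hA : ContDiffOn ℝ ∞ A U)
    (hBA : ∀ u ∈ U, ∀ ξ, fderiv ℝ A u ξ = fderiv ℝ B u (V u *ᵥ ξ)) :
    IsConservationLaw V U B A := by
  refine ⟨hB, hA, fun W u hW hmaps hsol z hz ξ η => ?_⟩
  have huz : HasFDerivAt u (fderiv ℝ u z) z :=
    ((hsol.1.contDiffAt (hW.mem_nhds hz)).differentiableAt (by simp)).hasFDerivAt
  have dB : HasFDerivAt B (fderiv ℝ B (u z)) (u z) :=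
    ((hB.contDiffAt (hU.mem_nhds (hmaps hz))).differentiableAt (by simp)).hasFDerivAt
  have dA : HasFDerivAt A (fderiv ℝ A (u z)) (u z) :=
    ((hA.contDiffAt (hU.mem_nhds (hmaps hz))).differentiableAt (by simp)).hasFDerivAt
  have key := ((dB.comp z huz).smul_const (ContinuousLinearMap.fst ℝ ℝ ℝ)).add
    ((dA.comp z huz).smul_const (ContinuousLinearMap.snd ℝ ℝ ℝ))
  have hs : fderiv ℝ u z (0, 1) = V (u z) *ᵥ fderiv ℝ u z (1, 0) := hsol.2 z hz
  have hx : fderiv ℝ A (u z) (fderiv ℝ u z (1, 0)) = fderiv ℝ B (u z) (fderiv ℝ u z (0, 1)) := by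
    rw [hs, hBA _ (hmaps hz)]
  have hdec : ∀ ζ : Plane, fderiv ℝ u z ζ =
      ζ.1 • fderiv ℝ u z (1, 0) + ζ.2 • fderiv ℝ u z (0, 1) := fun ζ => by
    rw [← map_smul, ← map_smul, ← map_add]; simp
  have key' : fderiv ℝ (fun y => B (u y) • ContinuousLinearMap.fst ℝ ℝ ℝ +
      A (u y) • ContinuousLinearMap.snd ℝ ℝ ℝ) z = _ := key.fderiv
  rw [extD, key']
  simp [hdec ξ, hdec η, hx]
  ring

theorem IsCharacteristicFrame.isConservationLaw (hU : IsOpen U)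
    (h : IsCharacteristicFrame assocMatrix U v l) (i j : Fin 3) (s t : ℝ) :
    IsConservationLaw assocMatrix U (fun u => s * density v i u + t * density v j u)
      (fun u => s * flux v i u + t * flux v j u) := by
  refine isConservationLaw_of_fderiv hU
    ((contDiffOn_const.mul (h.contDiffOn_density i)).add
      (contDiffOn_const.mul (h.contDiffOn_density j)))
    ((contDiffOn_const.mul (h.contDiffOn_flux i)).add
      (contDiffOn_const.mul (h.contDiffOn_flux j))) fun u hu ξ => ?_
  have hd : ∀ {f : Hodograph → ℝ}, ContDiffOn ℝ ∞ f U → HasFDerivAt f (fderiv ℝ f u) u :=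
    fun hf => ((hf.contDiffAt (hU.mem_nhds hu)).differentiableAt (by simp)).hasFDerivAt
  have e1 := (((hd (h.contDiffOn_density i)).const_mul s).add
    ((hd (h.contDiffOn_density j)).const_mul t)).fderiv
  have e2 := (((hd (h.contDiffOn_flux i)).const_mul s).add
    ((hd (h.contDiffOn_flux j)).const_mul t)).fderiv
  have e1' : fderiv ℝ (fun u => s * density v i u + t * density v j u) u = _ := e1
  have e2' : fderiv ℝ (fun u => s * flux v i u + t * flux v j u) u = _ := e2
  rw [e1', e2']
  simp [h.fderiv_flux hU hu]

/-- A matrix with three left eigenvectors spanning the space, for nonzero eigenvalues, is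
invertible. -/
theorem IsCharacteristicFrame.isUnit_of_left_eigen (h : IsCharacteristicFrame assocMatrix U v l)
    {u : Hodograph} (hu : u ∈ U) {K : Matrix (Fin 3) (Fin 3) ℝ} {k : Fin 3 → ℝ}
    (hk : ∀ i, k i ≠ 0) (hK : ∀ i, l i u ᵥ* K = k i • l i u) : IsUnit K := by
  rw [← Matrix.mulVec_injective_iff_isUnit]
  have hd : ∀ i η, eigenform l i u η = l i u ⬝ᵥ η := fun i η => by
    rw [eigenform_apply]; simp [dotProduct, Fin.sum_univ_three]
  intro ξ η e
  refine h.eq_of_eigenform_eq hu fun i => mul_left_cancel₀ (hk i) ?_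
  rw [hd, hd, ← smul_eq_mul, ← smul_eq_mul, ← smul_dotProduct, ← smul_dotProduct, ← hK i,
    ← Matrix.dotProduct_mulVec, ← Matrix.dotProduct_mulVec]
  exact congrArg _ e

/-- The system is reciprocally equivalent to one with the constant characteristic velocities
`1, -1, 0`. -/
theorem IsCharacteristicFrame.exists_reciprocal (hU : IsOpen U)
    (h : IsCharacteristicFrame assocMatrix U v l) :
    ∃ B A N M : Hodograph → ℝ, IsReciprocalTransformation assocMatrix U B A N M ∧
      ∃ k : Fin 3 → ℝ,
        IsCharacteristicFrame (reciprocalMatrix assocMatrix B A N M) U (fun i _ => k i) l := by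
  -- With D₀, D₁ the densities, Bv − A = D₀(v − v⁰) + D₁(v − v¹) and M − Nv = −D₀(v − v⁰) + D₁(v −
  -- v¹). At v = v⁰ and v = v¹ one summand survives and the ratio is 1 and −1; at v = v² the first
  -- expression vanishes, as D₀ = v¹ − v² and D₁ = v² − v⁰.
  set B : Hodograph → ℝ := fun u => 1 * density v 0 u + 1 * density v 1 u with hB
  set A : Hodograph → ℝ := fun u => 1 * flux v 0 u + 1 * flux v 1 u with hA
  set N : Hodograph → ℝ := fun u => 1 * density v 0 u + (-1) * density v 1 u with hN
  set M : Hodograph → ℝ := fun u => 1 * flux v 0 u + (-1) * flux v 1 u with hM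
  have d01 : ∀ u ∈ U, v 0 u - v 1 u ≠ 0 := fun u hu => sub_ne_zero.2 (h.ne hu (by decide))
  have d02 : ∀ u ∈ U, v 0 u - v 2 u ≠ 0 := fun u hu => sub_ne_zero.2 (h.ne hu (by decide))
  have d12 : ∀ u ∈ U, v 1 u - v 2 u ≠ 0 := fun u hu => sub_ne_zero.2 (h.ne hu (by decide))
  set k : Fin 3 → ℝ := ![1, -1, 0] with hk
  have a0 : (0 : Fin 3) + 1 = 1 := rfl
  have a1 : (0 : Fin 3) + 2 = 2 := rfl
  have a2 : (1 : Fin 3) + 1 = 2 := rfl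
  have a3 : (1 : Fin 3) + 2 = 0 := rfl
  have hne : ∀ u ∈ U, ∀ i, M u - N u * v i u ≠ 0 := by
    intro u hu i
    have n1 := mul_ne_zero (d01 u hu) (d02 u hu)
    have n2 := mul_ne_zero (d01 u hu) (d12 u hu)
    have n3 := mul_ne_zero (d02 u hu) (d12 u hu)
    fin_cases i <;> simp only [hM, hN, flux, density, a0, a1, a2, a3, Fin.zero_eta, Fin.mk_one,
      Fin.reduceFinMk] <;> intro e
    · exact n1 (by linear_combination -e)
    · exact n2 (by linear_combination e)
    · exact n3 (by linear_combination e / 2)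
  have heq : ∀ u ∈ U, ∀ i, B u * v i u - A u = k i * (M u - N u * v i u) := by
    intro u hu i
    fin_cases i <;> simp [hM, hN, hB, hA, hk, flux, density] <;> ring
  have hL : ∀ u ∈ U, ∀ i, l i u ᵥ* (M u • (1 : Matrix (Fin 3) (Fin 3) ℝ) - N u • assocMatrix u) =
      (M u - N u * v i u) • l i u := by
    intro u hu i
    rw [Matrix.vecMul_sub, Matrix.vecMul_smul, Matrix.vecMul_smul, h.left_eigen u hu i,
      Matrix.vecMul_one, sub_smul, mul_smul]
  have hunit : ∀ u ∈ U, IsUnit (M u • (1 : Matrix (Fin 3) (Fin 3) ℝ) - N u • assocMatrix u) :=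
    fun u hu => h.isUnit_of_left_eigen hu (hne u hu) (hL u hu)
  refine ⟨B, A, N, M, ⟨h.isConservationLaw hU 0 1 1 1, h.isConservationLaw hU 0 1 1 (-1), ?_, hunit⟩, k,
    ⟨fun _ => contDiffOn_const, h.smooth_covector, ?_, h.ne_zero, ?_⟩⟩
  · intro u hu e
    refine mul_ne_zero (mul_ne_zero (d01 u hu) (d02 u hu)) (d12 u hu) ?_
    simp only [hM, hN, hB, hA, flux, density, a0, a1, a2, a3] at e
    linear_combination -e / 2
  · intro u hu i j hij
    fin_cases i <;> fin_cases j <;> simp [hk] at hij ⊢ <;> norm_num at hij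
  · intro u hu i
    set K := M u • (1 : Matrix (Fin 3) (Fin 3) ℝ) - N u • assocMatrix u with hKdef
    have hKu : IsUnit K.det := (Matrix.isUnit_iff_isUnit_det K).1 (hunit u hu)
    have h1 : l i u ᵥ* (B u • assocMatrix u - A u • (1 : Matrix (Fin 3) (Fin 3) ℝ)) =
        k i • (l i u ᵥ* K) := by
      rw [hL u hu, smul_smul, ← heq u hu, Matrix.vecMul_sub, Matrix.vecMul_smul,
        Matrix.vecMul_smul, h.left_eigen u hu i, Matrix.vecMul_one, sub_smul, mul_smul]
    rw [reciprocalMatrix, ← Matrix.vecMul_vecMul, h1, Matrix.smul_vecMul, Matrix.vecMul_vecMul,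
      Matrix.mul_nonsing_inv _ hKu, Matrix.vecMul_one]

end Reciprocal

/-! ### Osculating planes of the cubic and the lines of the congruence. -/

section Congruence

variable {𝕜 : Type*} [RCLike 𝕜]

theorem hasDerivAt_cubic (τ : 𝕜) : HasDerivAt (cubic 𝕜) ![-3, -3 * τ, -3 * τ ^ 2] τ := by
  rw [hasDerivAt_pi]
  intro i
  fin_cases i
  · simpa [cubic] using (hasDerivAt_id τ).const_mul (-3 : 𝕜)
  · have := ((hasDerivAt_pow 2 τ).const_mul (-3 : 𝕜)).div_const 2
    refine this.congr_deriv ?_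
    simp
    ring
  · have := (hasDerivAt_pow 3 τ).fun_neg
    refine this.congr_deriv ?_
    simp

theorem deriv_cubic (τ : 𝕜) : deriv (cubic 𝕜) τ = ![-3, -3 * τ, -3 * τ ^ 2] :=
  (hasDerivAt_cubic τ).deriv

theorem deriv_deriv_cubic (τ : 𝕜) : deriv (deriv (cubic 𝕜)) τ = ![0, -3, -6 * τ] := by
  refine HasDerivAt.deriv ?_
  rw [funext (deriv_cubic (𝕜 := 𝕜)), hasDerivAt_pi]
  intro i
  fin_cases i
  · exact hasDerivAt_const τ (-3 : 𝕜)
  · simpa using (hasDerivAt_id τ).const_mul (-3 : 𝕜)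
  · refine ((hasDerivAt_pow 2 τ).const_mul (-3 : 𝕜)).congr_deriv ?_
    simp
    ring

theorem mem_oscPlane_iff {p : Fin 3 → 𝕜} {τ : 𝕜} :
    p ∈ oscPlane 𝕜 τ ↔ τ ^ 3 + p 0 * τ ^ 2 - 2 * p 1 * τ + p 2 = 0 := by
  rw [oscPlane, AffineSubspace.mem_mk', Submodule.mem_span_pair, deriv_cubic, deriv_deriv_cubic]
  constructor
  · rintro ⟨a, b, e⟩
    have e0 := congrFun e 0
    have e1 := congrFun e 1
    have e2 := congrFun e 2
    simp [cubic] at e0 e1 e2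
    -- The covector (τ², −2τ, 1) annihilates both γ'(τ) and γ''(τ).
    linear_combination -e0 * τ ^ 2 + 2 * τ * e1 - e2
  · intro h
    -- The coefficients are solved from the first two coordinates; the third is the equation of the
    -- plane.
    refine ⟨-(p 0 + 3 * τ) / 3, -(p 1 + 3 * τ ^ 2 / 2) / 3 + τ * (p 0 + 3 * τ) / 3, ?_⟩
    ext k
    fin_cases k <;> simp [cubic]
    · ring
    · linear_combination -h

theorem mem_tangentialLine_iff {p q : Fin 3 → 𝕜} {τ : 𝕜} :
    q ∈ tangentialLine 𝕜 p τ ↔ ∃ a : 𝕜, q - p = a • ![1, τ, τ ^ 2] := by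
  rw [tangentialLine, AffineSubspace.mem_mk', Submodule.mem_span_singleton, deriv_cubic]
  constructor
  · rintro ⟨a, e⟩
    refine ⟨-3 * a, ?_⟩
    rw [← vsub_eq_sub, ← e]
    ext k
    fin_cases k <;> simp <;> ring
  · rintro ⟨a, e⟩
    refine ⟨-a / 3, ?_⟩
    rw [vsub_eq_sub, e]
    ext k
    fin_cases k <;> simp <;> ring

theorem tangentialLine_injective (p : Fin 3 → 𝕜) :
    Function.Injective (tangentialLine 𝕜 p) := by
  intro τ σ e
  have h : p + ![1, τ, τ ^ 2] ∈ tangentialLine 𝕜 p σ :=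
    e ▸ mem_tangentialLine_iff.2 ⟨1, by simp⟩
  obtain ⟨a, ha⟩ := mem_tangentialLine_iff.1 h
  have e0 := congrFun ha 0
  have e1 := congrFun ha 1
  simp [-Matrix.add_cons] at e0 e1
  rw [e1, ← e0, one_mul]

/-- A line of the congruence stays in its osculating plane, so each of its points may serve as base
point. The lines through p are thus indexed by the osculating planes through p. -/
theorem setOf_mem_cubicCongruence (p : Fin 3 → 𝕜) :
    {ℓ | ℓ ∈ cubicCongruence 𝕜 ∧ p ∈ ℓ} = tangentialLine 𝕜 p '' {τ | p ∈ oscPlane 𝕜 τ} := by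
  ext ℓ
  constructor
  · rintro ⟨⟨τ, q, hq, rfl⟩, hp⟩
    refine ⟨τ, ?_, ?_⟩
    · obtain ⟨a, ha⟩ := mem_tangentialLine_iff.1 hp
      have e0 := congrFun ha 0
      have e1 := congrFun ha 1
      have e2 := congrFun ha 2
      simp at e0 e1 e2
      have := mem_oscPlane_iff.1 hq
      rw [mem_ofPred_eq, mem_oscPlane_iff]
      linear_combination this + τ ^ 2 * e0 - 2 * τ * e1 + e2
    · have := AffineSubspace.mk'_eq hp
      rw [← this, tangentialLine, tangentialLine, AffineSubspace.direction_mk']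
  · rintro ⟨τ, hτ, rfl⟩
    exact ⟨⟨τ, p, hτ, rfl⟩, AffineSubspace.self_mem_mk' _ _⟩

/-- The generic points are those where the discriminant of the characteristic cubic is nonzero: it
then has three distinct complex roots, and distinct roots give distinct directions. -/
theorem hasOrder_cubicCongruence : HasOrder (cubicCongruence ℂ) 3 := by
  classical
  set P : (Fin 3 → ℂ) → Cubic ℂ := fun p => ⟨1, p 0, -2 * p 1, p 2⟩ with hP
  set Q : MvPolynomial (Fin 3) ℂ := Cubic.discr
    ⟨1, MvPolynomial.X 0, MvPolynomial.C (-2) * MvPolynomial.X 1, MvPolynomial.X 2⟩ with hQ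
  have hev : ∀ p, MvPolynomial.eval p Q = (P p).discr := fun p => by
    simp [hQ, hP, Cubic.discr]
  refine ⟨Q, fun h0 => ?_, fun p hp => ?_⟩
  -- The cubic τ³ + 1 has discriminant −27.
  · have := hev ![0, 0, 1]
    simp [h0, hP, Cubic.discr] at this
  · rw [hev] at hp
    have ha : (P p).a ≠ 0 := one_ne_zero
    have hcard := Cubic.card_roots_of_discr_ne_zero (φ := RingHom.id ℂ) ha
      (IsAlgClosed.splits _) hp
    have hset : {τ | p ∈ oscPlane ℂ τ} =
        ((Cubic.map (RingHom.id ℂ) (P p)).roots.toFinset : Set ℂ) := by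
      ext τ
      rw [mem_ofPred_eq, mem_oscPlane_iff, Finset.mem_coe, Multiset.mem_toFinset,
        Cubic.mem_roots_iff (Cubic.ne_zero_of_a_ne_zero (by simp [hP, Cubic.map]))]
      simp [hP, Cubic.map]
      constructor <;> intro e <;> linear_combination e
    rw [setOf_mem_cubicCongruence, hset]
    refine ⟨(Finset.finite_toSet _).image _, ?_⟩
    rw [ncard_image_of_injective _ (tangentialLine_injective p), ncard_coe_finset, hcard]

end Congruence

/-! ### Characteristic planes and rarefaction lines. -/

section Rarefaction

variable {U : Set Hodograph} {v : Fin 3 → Hodograph → ℝ} {l : Fin 3 → Hodograph → Hodograph}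

theorem deriv_cubic_real (x : ℝ) : deriv (cubic ℝ) x = (-3 : ℝ) • eigenvector x := by
  rw [deriv_cubic]
  ext k
  fin_cases k <;> simp [eigenvector]

theorem IsCharacteristicFrame.setOf_mem_oscPlane (h : IsCharacteristicFrame assocMatrix U v l)
    {u : Hodograph} (hu : u ∈ U) : {τ | u ∈ oscPlane ℝ τ} = range fun i => v i u := by
  ext τ
  rw [mem_ofPred_eq, mem_oscPlane_iff]
  constructor
  · exact fun e => h.exists_eq_of_root hu e
  · rintro ⟨i, rfl⟩
    exact h.root hu i

theorem IsCharacteristicFrame.ncard_oscPlane (h : IsCharacteristicFrame assocMatrix U v l)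
    {u : Hodograph} (hu : u ∈ U) : {τ | u ∈ oscPlane ℝ τ}.ncard = 3 := by
  rw [h.setOf_mem_oscPlane hu, ← image_univ, ncard_image_of_injective _ (h.distinct u hu),
    ncard_univ, Nat.card_eq_fintype_card, Fintype.card_fin]

/-- In the basis of right eigenvectors ωⁱ reads off the i-th component up to a nonzero factor, and
γ'(vʲ) is −3 times the j-th basis vector. -/
theorem IsCharacteristicFrame.ker_eigenform (h : IsCharacteristicFrame assocMatrix U v l)
    {u : Hodograph} (hu : u ∈ U) (i : Fin 3) :
    LinearMap.ker (eigenform l i u : Hodograph →ₗ[ℝ] ℝ) =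
      Submodule.span ℝ ((fun j => deriv (cubic ℝ) (v j u)) '' {i}ᶜ) := by
  apply le_antisymm
  · intro ξ hξ
    have hξ' : eigenform l i u ξ = 0 := hξ
    set c : Fin 3 → ℝ := fun j =>
      eigenform l j u ξ / eigenform l j u (eigenvector (v j u)) with hc
    have hne := h.eigenform_eigenvector_self_ne hu
    have n1 := Fin.add_one_ne i
    have n2 := Fin.add_two_ne i
    have n3 := Fin.add_one_ne_add_two i
    have hdec : ξ = c (i + 1) • eigenvector (v (i + 1) u) +
        c (i + 2) • eigenvector (v (i + 2) u) := by
      refine h.eq_of_eigenform_eq hu fun j => ?_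
      rw [map_add, map_smul, map_smul, smul_eq_mul, smul_eq_mul]
      rcases Fin.eq_or_eq_add i j with rfl | rfl | rfl
      · rw [h.eigenform_eigenvector_of_ne hu n1.symm, h.eigenform_eigenvector_of_ne hu n2.symm,
          hξ', mul_zero, mul_zero, add_zero]
      · rw [h.eigenform_eigenvector_of_ne hu n3.symm, mul_zero, add_zero,
          div_mul_cancel₀ _ (hne _)]
      · rw [h.eigenform_eigenvector_of_ne hu n3, mul_zero, zero_add, div_mul_cancel₀ _ (hne _)]
    have hmem : ∀ j, i ≠ j → eigenvector (v j u) ∈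
        Submodule.span ℝ ((fun j => deriv (cubic ℝ) (v j u)) '' {i}ᶜ) := fun j hj => by
      have : eigenvector (v j u) = (-3 : ℝ)⁻¹ • deriv (cubic ℝ) (v j u) := by
        rw [deriv_cubic_real, smul_smul, inv_mul_cancel₀ (by norm_num), one_smul]
      rw [this]
      exact Submodule.smul_mem _ _ (Submodule.subset_span ⟨j, hj.symm, rfl⟩)
    rw [hdec]
    exact add_mem (Submodule.smul_mem _ _ (hmem _ n1)) (Submodule.smul_mem _ _ (hmem _ n2))
  · rw [Submodule.span_le]
    rintro _ ⟨j, hj, rfl⟩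
    change eigenform l i u (deriv (cubic ℝ) (v j u)) = 0
    rw [deriv_cubic_real, map_smul, h.eigenform_eigenvector_of_ne hu hj, smul_zero]

theorem assocMatrix_mulVec_eigenvector {u : Hodograph} {x : ℝ}
    (hx : x ^ 3 + u 0 * x ^ 2 - 2 * u 1 * x + u 2 = 0) :
    assocMatrix u *ᵥ eigenvector x = x • eigenvector x := by
  ext k
  fin_cases k <;>
    simp [assocMatrix, eigenvector, Matrix.mulVec, dotProduct, Fin.sum_univ_three]
  · ring
  · linear_combination -hx

theorem eq_smul_eigenvector {u ξ : Hodograph} {x : ℝ} (h : assocMatrix u *ᵥ ξ = x • ξ) :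
    ξ = ξ 0 • eigenvector x := by
  have e0 := congrFun h 0
  have e1 := congrFun h 1
  simp [assocMatrix, Matrix.mulVec, dotProduct, Fin.sum_univ_three] at e0 e1
  ext k
  fin_cases k <;> simp [eigenvector]
  · rw [e0]; ring
  · rw [e1, e0]; ring

/-- A characteristic velocity is constant along its rarefaction lines. -/
theorem IsCharacteristicFrame.velocity_line (h : IsCharacteristicFrame assocMatrix U v l)
    {u : Hodograph} (i : Fin 3) {I : Set ℝ} (hI : I.OrdConnected) (h0 : 0 ∈ I)
    {d : Hodograph} {κ : ℝ} (hd : d = κ • eigenvector (v i u)) (hmem : ∀ s ∈ I, u + s • d ∈ U)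
    {s : ℝ} (hs : s ∈ I) : v i (u + s • d) = v i u := by
  have hu : u ∈ U := by simpa using hmem 0 h0
  set c : ℝ → Hodograph := fun s => u + s • d with hc
  set x := v i u with hx
  -- The linear part x²a − 2xb + c of the equation of the osculating plane annihilates (1, x, x²),
  -- so x remains a root all along the line.
  have hprod : ∀ s ∈ I, (x - v i (c s)) * ((x - v (i + 1) (c s)) * (x - v (i + 2) (c s))) = 0 := by
    intro s hs
    obtain ⟨e0, e1, e2⟩ := h.vieta (hmem s hs) i
    have hr := h.root hu i
    have c0 : c s 0 = u 0 + s * κ := by simp [hc, hd, eigenvector, -Matrix.add_cons]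
    have c1 : c s 1 = u 1 + s * κ * x := by simp [hc, hd, eigenvector, -Matrix.add_cons]; ring
    have c2 : c s 2 = u 2 + s * κ * x ^ 2 := by simp [hc, hd, eigenvector, -Matrix.add_cons]; ring
    have e0' : c s 0 = _ := e0
    have e1' : c s 1 = _ := e1
    have e2' : c s 2 = _ := e2
    rw [c0] at e0'
    rw [c1] at e1'
    rw [c2] at e2'
    linear_combination hr + 2 * x * e1' - x ^ 2 * e0' - e2'
  -- It remains to exclude that x passes from the i-th root to another. As exactly one root equals x
  -- at each point, F is positive if this root is vⁱ, negative otherwise, and never zero; by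
  -- connectedness its sign at 0 persists.
  set F : ℝ → ℝ := fun s => ((x - v (i + 1) (c s)) * (x - v (i + 2) (c s))) ^ 2 -
    (x - v i (c s)) ^ 2 with hF
  have hcc : ContinuousOn c I := by
    simp only [hc]; fun_prop
  have hvc : ∀ j, ContinuousOn (fun s => v j (c s)) I := fun j =>
    (h.smooth_velocity j).continuousOn.comp hcc hmem
  have hFc : ContinuousOn F I :=
    (((continuousOn_const.sub (hvc _)).mul (continuousOn_const.sub (hvc _))).pow 2).sub
      ((continuousOn_const.sub (hvc _)).pow 2)
  have hFne : ∀ s ∈ I, F s ≠ 0 := by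
    intro s hs e
    have hsU := hmem s hs
    have e' : ((x - v (i + 1) (c s)) * (x - v (i + 2) (c s))) ^ 2 = (x - v i (c s)) ^ 2 :=
      sub_eq_zero.1 e
    have n1 := h.ne hsU (Fin.add_one_ne i)
    have n2 := h.ne hsU (Fin.add_two_ne i)
    rcases mul_eq_zero.1 (hprod s hs) with e1 | e1
    · rw [e1, zero_pow two_ne_zero, sq_eq_zero_iff, mul_eq_zero] at e'
      rcases e' with e2 | e2
      · exact n1 (show v i (c s) = v (i + 1) (c s) by linarith)
      · exact n2 (show v i (c s) = v (i + 2) (c s) by linarith)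
    · rw [e1, zero_pow two_ne_zero, eq_comm, sq_eq_zero_iff] at e'
      rcases mul_eq_zero.1 e1 with e2 | e2
      · exact n1 (show v i (c s) = v (i + 1) (c s) by linarith)
      · exact n2 (show v i (c s) = v (i + 2) (c s) by linarith)
  have hF0 : 0 ≤ F 0 := by
    simp only [hF, hc, zero_smul, add_zero, hx, sub_self, zero_pow two_ne_zero, sub_zero]
    positivity
  have hFs : 0 < F s := by
    by_contra hneg
    obtain ⟨t, ht, e⟩ := hI.isPreconnected.intermediate_value hs h0 hFc ⟨not_lt.1 hneg, hF0⟩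
    exact hFne t ht e
  rcases mul_eq_zero.1 (hprod s hs) with e1 | e1
  · exact (sub_eq_zero.1 e1).symm
  · simp only [hF, e1] at hFs
    nlinarith [sq_nonneg (x - v i (c s))]

theorem IsCharacteristicFrame.isRarefactionCurve_line
    (h : IsCharacteristicFrame assocMatrix U v l) {u : Hodograph} (i : Fin 3) {I : Set ℝ}
    (hI : I.OrdConnected) (h0 : 0 ∈ I)
    (hmem : ∀ s ∈ I, u + s • deriv (cubic ℝ) (v i u) ∈ U) :
    IsRarefactionCurve assocMatrix U (v i) I fun s => u + s • deriv (cubic ℝ) (v i u) := by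
  intro s hs
  have hd : HasDerivAt (fun s : ℝ => u + s • deriv (cubic ℝ) (v i u))
      (deriv (cubic ℝ) (v i u)) s := by
    simpa using ((hasDerivAt_id s).smul_const (deriv (cubic ℝ) (v i u))).const_add u
  have hv := h.velocity_line i hI h0 (deriv_cubic_real _) hmem hs
  refine ⟨hmem s hs, hd.differentiableAt, ?_, ?_⟩
  · rw [hd.deriv, deriv_cubic]
    intro e
    simpa using congrFun e 0
  · have hr := h.root (hmem s hs) i
    rw [hv] at hr
    rw [hd.deriv, hv]
    conv_lhs => rw [deriv_cubic_real (v i u)]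
    rw [deriv_cubic_real] at hr
    rw [Matrix.mulVec_smul, deriv_cubic_real (v i u), assocMatrix_mulVec_eigenvector hr, smul_comm]

theorem eq_of_hasDerivAt_zero {I : Set ℝ} (hI : I.OrdConnected) {f : ℝ → ℝ}
    (hf : ∀ s ∈ I, HasDerivAt f 0 s) {s t : ℝ} (hs : s ∈ I) (ht : t ∈ I) : f s = f t := by
  have := hI.convex.norm_image_sub_le_of_norm_hasDerivWithin_le (C := 0)
    (fun x hx => (hf x hx).hasDerivWithinAt) (by simp) ht hs
  rw [zero_mul, norm_le_zero_iff] at this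
  exact sub_eq_zero.1 this

/-- Linear degeneracy makes vⁱ constant along the curve, so the tangent direction (1, vⁱ, (vⁱ)²) is
constant as well. -/
theorem IsRarefactionCurve.mem_tangentialLine (hU : IsOpen U)
    (h : IsCharacteristicFrame assocMatrix U v l) {i : Fin 3} {I : Set ℝ} {c : ℝ → Hodograph}
    (hI : I.OrdConnected) (hc : IsRarefactionCurve assocMatrix U (v i) I c) {s₀ s : ℝ}
    (hs₀ : s₀ ∈ I) (hs : s ∈ I) : c s ∈ tangentialLine ℝ (c s₀) (v i (c s₀)) := by
  have hv : ∀ t ∈ I, v i (c t) = v i (c s₀) := fun t ht => by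
    refine eq_of_hasDerivAt_zero hI (f := fun t => v i (c t)) (fun t ht => ?_) ht hs₀
    obtain ⟨hU', hd, -, he⟩ := hc t ht
    refine ((h.differentiableAt hU hU' i).hasFDerivAt.comp_hasDerivAt t hd.hasDerivAt).congr_deriv
      ?_
    rw [eq_smul_eigenvector he, map_smul, h.fderiv_velocity_eigenvector_self hU hU', smul_zero]
  -- Constancy of u₁ − vⁱu₀ and u₂ − (vⁱ)²u₀ along the curve describes the line.
  have hk : ∀ k (a : ℝ), (∀ t ∈ I, deriv c t k = a * deriv c t 0) →
      c s k - a * c s 0 = c s₀ k - a * c s₀ 0 := fun k a hka => by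
    refine eq_of_hasDerivAt_zero hI (f := fun t => c t k - a * c t 0) (fun t ht => ?_) hs hs₀
    have hp := hasDerivAt_pi.1 (hc t ht).2.1.hasDerivAt
    refine ((hp k).sub ((hp 0).const_mul a)).congr_deriv ?_
    rw [hka t ht, sub_self]
  have hdc : ∀ t ∈ I, deriv c t = deriv c t 0 • eigenvector (v i (c s₀)) := fun t ht => by
    rw [← hv t ht]
    exact eq_smul_eigenvector (hc t ht).2.2.2
  have k1 := hk 1 (v i (c s₀)) fun t ht => by
    conv_lhs => rw [hdc t ht]
    simp [eigenvector, mul_comm]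
  have k2 := hk 2 (v i (c s₀) ^ 2) fun t ht => by
    conv_lhs => rw [hdc t ht]
    simp [eigenvector, mul_comm]
  refine mem_tangentialLine_iff.2 ⟨c s 0 - c s₀ 0, ?_⟩
  ext k
  fin_cases k <;> simp
  · linear_combination k1
  · linear_combination k2

end Rarefaction

/-! ### Calculus of exterior derivatives of 1-forms. -/

section ExteriorDerivative

variable {X Y : Type*} [NormedAddCommGroup X] [NormedSpace ℝ X] [NormedAddCommGroup Y]
  [NormedSpace ℝ Y]

theorem extD_congr {α β : X → X →L[ℝ] ℝ} {p : X} (h : α =ᶠ[nhds p] β) (ξ η : X) :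
    extD α p ξ η = extD β p ξ η := by
  rw [extD, extD, h.fderiv_eq]

theorem extD_add {α β : X → X →L[ℝ] ℝ} {p : X} (hα : DifferentiableAt ℝ α p)
    (hβ : DifferentiableAt ℝ β p) (ξ η : X) :
    extD (fun q => α q + β q) p ξ η = extD α p ξ η + extD β p ξ η := by
  have e := (hα.hasFDerivAt.add hβ.hasFDerivAt).fderiv
  have e' : fderiv ℝ (fun q => α q + β q) p = _ := e
  rw [extD, e', extD, extD]
  simp
  ring

theorem extD_smul {f : X → ℝ} {α : X → X →L[ℝ] ℝ} {p : X} (hf : DifferentiableAt ℝ f p)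
    (hα : DifferentiableAt ℝ α p) (ξ η : X) :
    extD (fun q => f q • α q) p ξ η = wedge (fderiv ℝ f p) (α p) ξ η + f p * extD α p ξ η := by
  have e := (hf.hasFDerivAt.smul hα.hasFDerivAt).fderiv
  have e' : fderiv ℝ (fun q => f q • α q) p = _ := e
  rw [extD, e', extD, wedge]
  simp
  ring

theorem extD_fderiv {f : X → ℝ} {p : X} (hf : ContDiffAt ℝ 2 f p) (ξ η : X) :
    extD (fderiv ℝ f) p ξ η = 0 :=
  sub_eq_zero.2 ((hf.isSymmSndFDerivAt (by simp)).eq ξ η)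

/-- Pull-back commutes with d: the terms with the second derivative of f cancel by its symmetry. -/
theorem extD_comp {α : Y → Y →L[ℝ] ℝ} {f : X → Y} {p : X} (hα : DifferentiableAt ℝ α (f p))
    (hf : ContDiffAt ℝ 2 f p) (ξ η : X) :
    extD (fun q => (α (f q)).comp (fderiv ℝ f q)) p ξ η =
      extD α (f p) (fderiv ℝ f p ξ) (fderiv ℝ f p η) := by
  have h1 := hα.hasFDerivAt.comp p (hf.differentiableAt (by simp)).hasFDerivAt
  have h2 : HasFDerivAt (fderiv ℝ f) _ p :=
    ((hf.fderiv_right (m := 1) (by norm_num)).differentiableAt (by simp)).hasFDerivAt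
  have e := (h1.clm_comp h2).fderiv
  have e' : fderiv ℝ (fun q => (α (f q)).comp (fderiv ℝ f q)) p = _ := e
  have hs := (hf.isSymmSndFDerivAt (by simp)).eq ξ η
  rw [extD, e', extD]
  simp [hs]

end ExteriorDerivative

/-! ### Covectors and 2-forms in the plane. -/

section PlaneForms

theorem plane_eq (ξ : Plane) : ξ = ξ.1 • ((1, 0) : Plane) + ξ.2 • ((0, 1) : Plane) := by
  ext <;> simp

theorem clm_plane_apply {F : Type*} [NormedAddCommGroup F] [NormedSpace ℝ F]
    (α : Plane →L[ℝ] F) (ξ : Plane) : α ξ = ξ.1 • α (1, 0) + ξ.2 • α (0, 1) := by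
  rw [← map_smul, ← map_smul, ← map_add, ← plane_eq]

theorem clm_plane_ext {F : Type*} [NormedAddCommGroup F] [NormedSpace ℝ F]
    {α β : Plane →L[ℝ] F} (h1 : α (1, 0) = β (1, 0)) (h2 : α (0, 1) = β (0, 1)) : α = β := by
  refine ContinuousLinearMap.ext fun ξ => ?_
  rw [clm_plane_apply α, clm_plane_apply β, h1, h2]

/-- The coefficient of `α ∧ β` with respect to the area form of the plane. -/
noncomputable def planeDet (α β : Plane →L[ℝ] ℝ) : ℝ := wedge α β (1, 0) (0, 1)

theorem planeDet_def (α β : Plane →L[ℝ] ℝ) :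
    planeDet α β = α (1, 0) * β (0, 1) - α (0, 1) * β (1, 0) := rfl

theorem wedge_plane (α β : Plane →L[ℝ] ℝ) (ξ ζ : Plane) :
    wedge α β ξ ζ = planeDet α β * (ξ.1 * ζ.2 - ξ.2 * ζ.1) := by
  rw [wedge, clm_plane_apply α ξ, clm_plane_apply β ξ, clm_plane_apply α ζ, clm_plane_apply β ζ,
    planeDet_def]
  simp only [smul_eq_mul]
  ring

theorem extD_plane (α : Plane → Plane →L[ℝ] ℝ) (w ξ ζ : Plane) :
    extD α w ξ ζ = extD α w (1, 0) (0, 1) * (ξ.1 * ζ.2 - ξ.2 * ζ.1) := by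
  have h := fun ξ ζ : Plane => clm_plane_apply (fderiv ℝ α w ξ) ζ
  have h' := clm_plane_apply (fderiv ℝ α w)
  rw [extD, h ξ ζ, h ζ ξ, h' ξ, h' ζ, extD]
  simp only [smul_eq_mul, _root_.add_apply, _root_.smul_apply]
  ring

theorem planeDet_ne_zero {α β : Plane →L[ℝ] ℝ} (h : LinearIndependent ℝ ![α, β]) :
    planeDet α β ≠ 0 := by
  intro e
  rw [planeDet_def] at e
  -- A zero determinant gives the relation β(e)α − α(e)β = 0 for both basis vectors e; independence
  -- then makes α vanish.
  rw [LinearIndependent.pair_iff] at h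
  obtain ⟨b1, a1⟩ := h (β (1, 0)) (-α (1, 0)) (clm_plane_ext (by simp; ring)
    (by simp; linear_combination -e))
  obtain ⟨b2, a2⟩ := h (β (0, 1)) (-α (0, 1)) (clm_plane_ext (by simp; linear_combination e)
    (by simp; ring))
  have := (h 1 0 (clm_plane_ext (by simpa using a1) (by simpa using a2))).1
  exact one_ne_zero this

/-- A covector whose exterior products with two independent covectors vanish is zero. -/
theorem eq_zero_of_planeDet {α β γ : Plane →L[ℝ] ℝ} (h : planeDet α β ≠ 0)
    (h1 : planeDet γ α = 0) (h2 : planeDet γ β = 0) : γ = 0 := by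
  rw [planeDet_def] at h h1 h2
  refine clm_plane_ext (mul_left_cancel₀ h ?_) (mul_left_cancel₀ h ?_)
  · simp only [_root_.zero_apply, mul_zero]
    linear_combination α (1, 0) * h2 - β (1, 0) * h1
  · simp only [_root_.zero_apply, mul_zero]
    linear_combination α (0, 1) * h2 - β (0, 1) * h1

end PlaneForms

/-! ### Hexagonal webs and closed triples. -/

section Webs

/-- Closed 1-forms with zero sum which define the three families of curves of a 3-web. -/
structure IsClosedTriple (η : Fin 3 → Plane → Plane →L[ℝ] ℝ) (O : Set Plane)
    (β : Fin 3 → Plane → Plane →L[ℝ] ℝ) : Prop where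
  smooth : ∀ i, ContDiffOn ℝ ∞ (β i) O
  closed : ∀ i, ∀ y ∈ O, ∀ ξ ζ, extD (β i) y ξ ζ = 0
  family : ∀ i, ∀ y ∈ O, ∃ k : ℝ, k ≠ 0 ∧ β i y = k • η i y
  sum_eq_zero : ∀ y ∈ O, β 0 y + β 1 y + β 2 y = 0

variable {η β : Fin 3 → Plane → Plane →L[ℝ] ℝ} {W O : Set Plane}
  {φ₁ φ₂ φ : Plane → Plane →L[ℝ] ℝ}

theorem ContDiffOn.planeDet {α β : Plane → Plane →L[ℝ] ℝ} {n : WithTop ℕ∞}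
    (hα : ContDiffOn ℝ n α W) (hβ : ContDiffOn ℝ n β W) :
    ContDiffOn ℝ n (fun w => planeDet (α w) (β w)) W :=
  ((hα.clm_apply contDiffOn_const).mul (hβ.clm_apply contDiffOn_const)).sub
    ((hα.clm_apply contDiffOn_const).mul (hβ.clm_apply contDiffOn_const))

theorem ContDiffOn.extD (hW : IsOpen W) {α : Plane → Plane →L[ℝ] ℝ}
    (hα : ContDiffOn ℝ ∞ α W) (ξ ζ : Plane) :
    ContDiffOn ℝ ∞ (fun w => extD α w ξ ζ) W := by
  have h : ContDiffOn ℝ ∞ (fderiv ℝ α) W := hα.fderiv_of_isOpen hW (by simp)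
  exact ((h.clm_apply contDiffOn_const).clm_apply contDiffOn_const).sub
    ((h.clm_apply contDiffOn_const).clm_apply contDiffOn_const)

theorem planeDet_smul_smul (a b : ℝ) (α β : Plane →L[ℝ] ℝ) :
    planeDet (a • α) (b • β) = a * b * planeDet α β := by
  simp only [planeDet_def, _root_.smul_apply, smul_eq_mul]
  ring

/-- The normalization is Cramer's relation [12]η⁰ − [02]η¹ + [01]η² = 0 for three covectors of a
plane. As φ₁, φ₂ form a coframe, the two structure equations determine the components of φ. -/
theorem exists_isWebConnection (hW : IsOpen W) (hη : ∀ i, ContDiffOn ℝ ∞ (η i) W)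
    (h01 : ∀ w ∈ W, planeDet (η 0 w) (η 1 w) ≠ 0) (h12 : ∀ w ∈ W, planeDet (η 1 w) (η 2 w) ≠ 0)
    (h02 : ∀ w ∈ W, planeDet (η 0 w) (η 2 w) ≠ 0) :
    ∃ φ₁ φ₂ φ, IsWebConnection η W φ₁ φ₂ φ := by
  set φ₁ : Plane → Plane →L[ℝ] ℝ := fun w => (-planeDet (η 1 w) (η 2 w)) • η 0 w with hφ₁
  set φ₂ : Plane → Plane →L[ℝ] ℝ := fun w => (-planeDet (η 0 w) (η 2 w)) • η 1 w with hφ₂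
  have s₁ : ContDiffOn ℝ ∞ φ₁ W := (((hη 1).planeDet (hη 2)).neg).smul (hη 0)
  have s₂ : ContDiffOn ℝ ∞ φ₂ W := (((hη 0).planeDet (hη 2)).neg).smul (hη 1)
  have hdet : ∀ w ∈ W, planeDet (φ₁ w) (φ₂ w) ≠ 0 := fun w hw => by
    simp only [hφ₁, hφ₂]
    rw [planeDet_smul_smul]
    exact mul_ne_zero (mul_ne_zero (neg_ne_zero.2 (h12 w hw)) (neg_ne_zero.2 (h02 w hw)))
      (h01 w hw)
  set c₁ : Plane → ℝ := fun w => extD φ₁ w (1, 0) (0, 1) with hc₁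
  set c₂ : Plane → ℝ := fun w => extD φ₂ w (1, 0) (0, 1) with hc₂
  set φ : Plane → Plane →L[ℝ] ℝ := fun w => (c₂ w / planeDet (φ₁ w) (φ₂ w)) • φ₁ w -
    (c₁ w / planeDet (φ₁ w) (φ₂ w)) • φ₂ w with hφ
  have s : ContDiffOn ℝ ∞ φ W :=
    (((s₂.extD hW _ _).div (s₁.planeDet s₂) hdet).smul s₁).sub
      (((s₁.extD hW _ _).div (s₁.planeDet s₂) hdet).smul s₂)
  refine ⟨φ₁, φ₂, φ, s₁, s₂, s, fun w hw => ⟨_, neg_ne_zero.2 (h12 w hw), rfl⟩,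
    fun w hw => ⟨_, neg_ne_zero.2 (h02 w hw), rfl⟩, fun w hw => ⟨_, h01 w hw, ?_⟩,
    fun w hw ξ ζ => ?_, fun w hw ξ ζ => ?_⟩
  · simp only [hφ₁, hφ₂]
    apply clm_plane_ext <;>
    · simp only [planeDet_def, _root_.sub_apply, _root_.smul_apply, smul_eq_mul]
      ring
  · rw [extD_plane, wedge_plane]
    congr 1
    have hd := hdet w hw
    have e : planeDet (φ w) (φ₁ w) =
        c₁ w / planeDet (φ₁ w) (φ₂ w) * planeDet (φ₁ w) (φ₂ w) := by
      simp only [hφ]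
      generalize c₁ w / planeDet (φ₁ w) (φ₂ w) = a
      generalize c₂ w / planeDet (φ₁ w) (φ₂ w) = b
      simp only [planeDet_def, _root_.sub_apply, _root_.smul_apply, smul_eq_mul]
      ring
    rw [e, div_mul_cancel₀ _ hd]
  · rw [extD_plane, wedge_plane]
    congr 1
    have hd := hdet w hw
    have e : planeDet (φ w) (φ₂ w) =
        c₂ w / planeDet (φ₁ w) (φ₂ w) * planeDet (φ₁ w) (φ₂ w) := by
      simp only [hφ]
      generalize c₁ w / planeDet (φ₁ w) (φ₂ w) = a
      generalize c₂ w / planeDet (φ₁ w) (φ₂ w) = b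
      simp only [planeDet_def, _root_.sub_apply, _root_.smul_apply, smul_eq_mul]
      ring
    rw [e, div_mul_cancel₀ _ hd]

theorem IsWebConnection.planeDet_ne_zero (h : IsWebConnection η W φ₁ φ₂ φ)
    (h01 : ∀ w ∈ W, planeDet (η 0 w) (η 1 w) ≠ 0) {w : Plane} (hw : w ∈ W) :
    planeDet (φ₁ w) (φ₂ w) ≠ 0 := by
  obtain ⟨k₁, hk₁, e₁⟩ := h.first_family w hw
  obtain ⟨k₂, hk₂, e₂⟩ := h.second_family w hw
  rw [e₁, e₂, planeDet_smul_smul]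
  exact mul_ne_zero (mul_ne_zero hk₁ hk₂) (h01 w hw)

/-- A closed triple is a common multiple of the normalized forms of a web connection. -/
theorem IsWebConnection.exists_factor (h : IsWebConnection η W φ₁ φ₂ φ)
    (h01 : ∀ w ∈ W, planeDet (η 0 w) (η 1 w) ≠ 0) (hO : O ⊆ W)
    (hβ : IsClosedTriple η O β) {y : Plane} (hy : y ∈ O) :
    ∃ a : ℝ, a ≠ 0 ∧ β 0 y = a • φ₁ y ∧ β 1 y = -(a • φ₂ y) := by
  obtain ⟨k₁, hk₁, e₁⟩ := h.first_family y (hO hy)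
  obtain ⟨k₂, hk₂, e₂⟩ := h.second_family y (hO hy)
  obtain ⟨k₃, hk₃, e₃⟩ := h.third_family y (hO hy)
  obtain ⟨m₁, hm₁, f₁⟩ := hβ.family 0 y hy
  obtain ⟨m₂, hm₂, f₂⟩ := hβ.family 1 y hy
  obtain ⟨m₃, hm₃, f₃⟩ := hβ.family 2 y hy
  have hs := hβ.sum_eq_zero y hy
  have hη₁ : η 0 y = k₁⁻¹ • φ₁ y := by rw [e₁, smul_smul, inv_mul_cancel₀ hk₁, one_smul]
  have hη₂ : η 1 y = k₂⁻¹ • φ₂ y := by rw [e₂, smul_smul, inv_mul_cancel₀ hk₂, one_smul]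
  have hη₃ : η 2 y = k₃⁻¹ • (φ₁ y - φ₂ y) := by
    rw [e₃, smul_smul, inv_mul_cancel₀ hk₃, one_smul]
  have hdet := h.planeDet_ne_zero h01 (hO hy)
  rw [hη₁, smul_smul] at f₁
  rw [hη₂, smul_smul] at f₂
  rw [hη₃, smul_smul] at f₃
  set a := m₁ * k₁⁻¹ with ha
  set b := m₂ * k₂⁻¹
  set c := m₃ * k₃⁻¹
  rw [f₁, f₂, f₃] at hs
  have hs1 := DFunLike.congr_fun hs (1, 0)
  have hs2 := DFunLike.congr_fun hs (0, 1)
  simp only [_root_.add_apply, _root_.smul_apply, _root_.sub_apply, smul_eq_mul,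
    _root_.zero_apply] at hs1 hs2
  rw [planeDet_def] at hdet
  -- Wedging the vanishing sum aφ₁ + bφ₂ + c(φ₁ − φ₂) with φ₂, and below with φ₁, isolates each
  -- coefficient.
  have hac : a + c = 0 := mul_right_cancel₀ hdet (by
    rw [zero_mul]
    linear_combination hs1 * φ₂ y (0, 1) - hs2 * φ₂ y (1, 0))
  have hbc : b - c = 0 := mul_right_cancel₀ hdet (by
    rw [zero_mul]
    linear_combination hs2 * φ₁ y (1, 0) - hs1 * φ₁ y (0, 1))
  refine ⟨a, mul_ne_zero hm₁ (inv_ne_zero hk₁), f₁, ?_⟩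
  rw [f₂, show b = -a by linarith]
  exact clm_plane_ext (by simp) (by simp)

/-- Closedness of aφ₁ and −aφ₂ says that da + aφ has zero exterior product with φ₁ and φ₂. Hence φ =
−d log|a| is exact on O. -/
theorem IsWebConnection.extD_eq_zero (h : IsWebConnection η W φ₁ φ₂ φ)
    (h01 : ∀ w ∈ W, planeDet (η 0 w) (η 1 w) ≠ 0) (hO : IsOpen O)
    (hOW : O ⊆ W) (hβ : IsClosedTriple η O β) {w : Plane} (hw : w ∈ O) (ξ ζ : Plane) :
    extD φ w ξ ζ = 0 := by
  choose! a ha0 ha1 ha2 using fun y (hy : y ∈ O) => h.exists_factor h01 hOW hβ hy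
  have hdet := fun y (hy : y ∈ O) => h.planeDet_ne_zero h01 (hOW hy)
  have s₁ := h.smooth_one.mono hOW
  have s₂ := h.smooth_two.mono hOW
  -- The factor was chosen point by point; it is smooth as a quotient of determinants.
  have sa : ContDiffOn ℝ ∞ a O := by
    refine (((hβ.smooth 0).planeDet s₂).div (s₁.planeDet s₂) hdet).congr fun y hy => ?_
    rw [Pi.div_apply, eq_div_iff (hdet y hy), ha1 y hy]
    simp only [planeDet_def, _root_.smul_apply, smul_eq_mul]
    ring
  have hdiff : ∀ {F : Type} [NormedAddCommGroup F] [NormedSpace ℝ F] {f : Plane → F},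
      ContDiffOn ℝ ∞ f O → ∀ y ∈ O, DifferentiableAt ℝ f y := fun hf y hy =>
    (hf.contDiffAt (hO.mem_nhds hy)).differentiableAt (by simp)
  -- `Real.log` is the logarithm of the absolute value, so the sign of a plays no role.
  have hφ : ∀ y ∈ O, φ y = fderiv ℝ (fun y => -Real.log (a y)) y := by
    intro y hy
    have c₁ : extD (fun y => a y • φ₁ y) y (1, 0) (0, 1) = 0 := by
      refine Eq.trans ?_ (hβ.closed 0 y hy (1, 0) (0, 1))
      refine extD_congr ?_ _ _
      filter_upwards [hO.mem_nhds hy] with z hz using (ha1 z hz).symm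
    have c₂ : extD (fun y => (-a y) • φ₂ y) y (1, 0) (0, 1) = 0 := by
      refine Eq.trans ?_ (hβ.closed 1 y hy (1, 0) (0, 1))
      refine extD_congr ?_ _ _
      filter_upwards [hO.mem_nhds hy] with z hz
      rw [ha2 z hz]
      exact clm_plane_ext (by simp) (by simp)
    rw [extD_smul (hdiff sa y hy) (hdiff s₁ y hy), h.deriv_one y (hOW hy)] at c₁
    rw [extD_smul (hdiff sa y hy).fun_neg (hdiff s₂ y hy), h.deriv_two y (hOW hy),
      fderiv_fun_neg] at c₂
    have e : fderiv ℝ a y + a y • φ y = 0 := by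
      refine eq_zero_of_planeDet (hdet y hy) ?_ ?_
      · rw [wedge, wedge] at c₁
        simp only [planeDet_def, _root_.add_apply, _root_.smul_apply, smul_eq_mul]
        linear_combination c₁
      · rw [wedge, wedge] at c₂
        simp only [_root_.neg_apply] at c₂
        simp only [planeDet_def, _root_.add_apply, _root_.smul_apply, smul_eq_mul]
        linear_combination -c₂
    have hl : HasFDerivAt (fun y => -Real.log (a y)) (-((a y)⁻¹ • fderiv ℝ a y)) y :=
      ((hdiff sa y hy).hasFDerivAt.log (ha0 y hy)).neg
    rw [hl.fderiv, eq_neg_of_add_eq_zero_left e, smul_neg, neg_neg, smul_smul,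
      inv_mul_cancel₀ (ha0 y hy), one_smul]
  have hl2 : ContDiffAt ℝ 2 (fun y => -Real.log (a y)) w :=
    (((sa.contDiffAt (hO.mem_nhds hw)).of_le (WithTop.coe_le_coe.2 (le_top : (2 : ℕ∞) ≤ ⊤))).log (ha0 w hw)).neg
  rw [← extD_fderiv hl2 ξ ζ]
  refine extD_congr ?_ _ _
  filter_upwards [hO.mem_nhds hw] with y hy using hφ y hy

/-- The connection is built on the whole of W, whereas the vanishing of its curvature is local and
may be tested with local triples. -/
theorem isHexagonalWeb_of_closedTriple (hW : IsOpen W) (hη : ∀ i, ContDiffOn ℝ ∞ (η i) W)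
    (h01 : ∀ w ∈ W, planeDet (η 0 w) (η 1 w) ≠ 0) (h12 : ∀ w ∈ W, planeDet (η 1 w) (η 2 w) ≠ 0)
    (h02 : ∀ w ∈ W, planeDet (η 0 w) (η 2 w) ≠ 0)
    (h : ∀ w ∈ W, ∃ O, IsOpen O ∧ w ∈ O ∧ O ⊆ W ∧ ∃ β, IsClosedTriple η O β) :
    IsHexagonalWeb η W := by
  obtain ⟨φ₁, φ₂, φ, hφ⟩ := exists_isWebConnection hW hη h01 h12 h02
  refine ⟨φ₁, φ₂, φ, hφ, fun w hw => ?_⟩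
  obtain ⟨O, hO, hwO, hOW, β, hβ⟩ := h w hw
  exact hφ.extD_eq_zero h01 hO hOW hβ hwO

/-- Smooth closed forms have smooth primitives on convex open sets. -/
theorem exists_primitive {B : Set Plane} (hB : IsOpen B) (hc : Convex ℝ B)
    {α : Plane → Plane →L[ℝ] ℝ} (hα : ContDiffOn ℝ ∞ α B)
    (hcl : ∀ y ∈ B, ∀ ξ ζ, extD α y ξ ζ = 0) :
    ∃ g : Plane → ℝ, ContDiffOn ℝ ∞ g B ∧ ∀ y ∈ B, HasFDerivAt g (α y) y := by
  obtain ⟨g, hg⟩ := hc.exists_forall_hasFDerivAt_of_fderiv_symmetric hB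
    (hα.differentiableOn (by simp)) fun y hy ξ ζ => sub_eq_zero.1 (hcl y hy ξ ζ)
  refine ⟨g, ?_, hg⟩
  rw [contDiffOn_infty_iff_fderiv_of_isOpen hB]
  exact ⟨fun y hy => (hg y hy).differentiableAt.differentiableWithinAt,
    hα.congr fun y hy => (hg y hy).fderiv⟩

/-- On a ball φ = dg, and the integrating factor a = exp(−g) makes aφ₁ and aφ₂ closed; the third
form, −a(φ₁ − φ₂), belongs to the third family. -/
theorem IsHexagonalWeb.exists_closedTriple (hW : IsOpen W) (h : IsHexagonalWeb η W) {w : Plane}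
    (hw : w ∈ W) : ∃ O, IsOpen O ∧ w ∈ O ∧ O ⊆ W ∧ ∃ β, IsClosedTriple η O β := by
  obtain ⟨φ₁, φ₂, φ, hφ, hcl⟩ := h
  obtain ⟨ε, hε, hball⟩ := Metric.isOpen_iff.1 hW w hw
  have hO : IsOpen (Metric.ball w ε) := Metric.isOpen_ball
  obtain ⟨g, sg, hg⟩ := exists_primitive hO (convex_ball w ε) (hφ.smooth_conn.mono hball)
    fun y hy => hcl y (hball hy)
  set a : Plane → ℝ := fun y => Real.exp (-g y) with ha
  have sa : ContDiffOn ℝ ∞ a (Metric.ball w ε) := sg.neg.exp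
  have da : ∀ y ∈ Metric.ball w ε, HasFDerivAt a (-(a y • φ y)) y := fun y hy => by
    simpa [ha] using (hg y hy).neg.exp
  have ha0 : ∀ y, a y ≠ 0 := fun y => (Real.exp_pos _).ne'
  have s₁ := hφ.smooth_one.mono hball
  have s₂ := hφ.smooth_two.mono hball
  have hdiff : ∀ {f : Plane → Plane →L[ℝ] ℝ}, ContDiffOn ℝ ∞ f (Metric.ball w ε) →
      ∀ y ∈ Metric.ball w ε, DifferentiableAt ℝ f y := fun hf y hy =>
    (hf.contDiffAt (hO.mem_nhds hy)).differentiableAt (by simp)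
  have c₁ : ∀ y ∈ Metric.ball w ε, ∀ ξ ζ, extD (fun y => a y • φ₁ y) y ξ ζ = 0 := by
    intro y hy ξ ζ
    rw [extD_smul (da y hy).differentiableAt (hdiff s₁ y hy), (da y hy).fderiv,
      hφ.deriv_one y (hball hy), wedge, wedge]
    simp
    ring
  have c₂ : ∀ y ∈ Metric.ball w ε, ∀ ξ ζ, extD (fun y => (-a y) • φ₂ y) y ξ ζ = 0 := by
    intro y hy ξ ζ
    rw [extD_smul (da y hy).differentiableAt.fun_neg (hdiff s₂ y hy), (da y hy).fun_neg.fderiv,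
      hφ.deriv_two y (hball hy), wedge, wedge]
    simp
    ring
  have t₁ : ContDiffOn ℝ ∞ (fun y => a y • φ₁ y) (Metric.ball w ε) := sa.smul s₁
  have t₂ : ContDiffOn ℝ ∞ (fun y => (-a y) • φ₂ y) (Metric.ball w ε) := sa.neg.smul s₂
  refine ⟨_, hO, Metric.mem_ball_self hε, hball, ![fun y => a y • φ₁ y, fun y => (-a y) • φ₂ y,
    fun y => (-1 : ℝ) • (a y • φ₁ y + (-a y) • φ₂ y)], ?_, ?_, ?_, ?_⟩
  · intro i
    fin_cases i
    exacts [t₁, t₂, (contDiffOn_const (c := (-1 : ℝ))).smul (t₁.add t₂)]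
  · intro i y hy ξ ζ
    fin_cases i
    · exact c₁ y hy ξ ζ
    · exact c₂ y hy ξ ζ
    · change extD (fun y => (-1 : ℝ) • (a y • φ₁ y + (-a y) • φ₂ y)) y ξ ζ = 0
      rw [extD_smul (differentiableAt_const _) ((hdiff t₁ y hy).fun_add (hdiff t₂ y hy)),
        extD_add (hdiff t₁ y hy) (hdiff t₂ y hy), c₁ y hy, c₂ y hy]
      simp [wedge]
  · intro i y hy
    fin_cases i
    · obtain ⟨k, hk, e⟩ := hφ.first_family y (hball hy)
      exact ⟨a y * k, mul_ne_zero (ha0 y) hk, by simp [e, smul_smul]⟩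
    · obtain ⟨k, hk, e⟩ := hφ.second_family y (hball hy)
      exact ⟨-a y * k, mul_ne_zero (neg_ne_zero.2 (ha0 y)) hk, by simp [e, smul_smul]⟩
    · obtain ⟨k, hk, e⟩ := hφ.third_family y (hball hy)
      refine ⟨-a y * k, mul_ne_zero (neg_ne_zero.2 (ha0 y)) hk, ?_⟩
      have : (-a y * k) • η 2 y = (-a y) • (φ₁ y - φ₂ y) := by rw [e, smul_smul]
      simp only [Fin.reduceFinMk, this, Matrix.cons_val]
      module
  · intro y hy
    simp only [Matrix.cons_val_zero, Matrix.cons_val_one, Matrix.cons_val]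
    module

end Webs

/-! ### Smooth local inverses. -/

section InverseFunction

variable {E : Type*} [NormedAddCommGroup E] [NormedSpace ℝ E] [FiniteDimensional ℝ E]

/-- The smooth inverse function theorem on an open set. -/
theorem exists_openPartialHomeomorph {F : E → E} {Ω : Set E} (hΩ : IsOpen Ω)
    (hF : ContDiffOn ℝ ∞ F Ω) (hinj : ∀ y ∈ Ω, Function.Injective (fderiv ℝ F y)) {w : E}
    (hw : w ∈ Ω) :
    ∃ e : OpenPartialHomeomorph E E, w ∈ e.source ∧ e.source ⊆ Ω ∧ (∀ y, e y = F y) ∧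
      ContDiffOn ℝ ∞ e.symm e.target := by
  have : CompleteSpace E := FiniteDimensional.complete ℝ E
  have heq : ∀ y ∈ Ω, ∃ A : E ≃L[ℝ] E, (A : E →L[ℝ] E) = fderiv ℝ F y := fun y hy =>
    ⟨(LinearEquiv.ofInjectiveEndo (fderiv ℝ F y : E →ₗ[ℝ] E) (hinj y hy)).toContinuousLinearEquiv,
      by ext x; rfl⟩
  have hFat : ∀ y ∈ Ω, ContDiffAt ℝ ∞ F y := fun y hy => hF.contDiffAt (hΩ.mem_nhds hy)
  have hder : ∀ y ∈ Ω, HasFDerivAt F (fderiv ℝ F y) y := fun y hy =>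
    ((hFat y hy).differentiableAt (by simp)).hasFDerivAt
  obtain ⟨A, hA⟩ := heq w hw
  set e₀ := (hFat w hw).toOpenPartialHomeomorph F (hA ▸ hder w hw) (by simp) with he₀
  have hcoe : ∀ y, e₀ y = F y := fun y => by
    rw [he₀, ContDiffAt.toOpenPartialHomeomorph_coe]
  have hw₀ : w ∈ e₀.source := ContDiffAt.mem_toOpenPartialHomeomorph_source _ _ _
  -- After restriction to Ω the derivative is invertible on the whole source, so the inverse is
  -- smooth on the whole target and not only at the image of w.
  refine ⟨e₀.restrOpen Ω hΩ, ⟨hw₀, hw⟩, fun y hy => hy.2, hcoe, fun z hz => ?_⟩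
  have hs : (e₀.restrOpen Ω hΩ).symm z ∈ (e₀.restrOpen Ω hΩ).source :=
    (e₀.restrOpen Ω hΩ).map_target hz
  obtain ⟨B, hB⟩ := heq _ hs.2
  have hfun : ⇑(e₀.restrOpen Ω hΩ) = F := funext hcoe
  refine ((e₀.restrOpen Ω hΩ).contDiffAt_symm hz (f₀' := B) ?_ ?_).contDiffWithinAt
  · rw [hfun, hB]; exact hder _ hs.2
  · rw [hfun]; exact hFat _ hs.2

end InverseFunction

/-! ### From solutions to hexagonal webs. -/

section Surfaces

variable {S : Set Hodograph} {W W' : Set Plane} {r r' : Plane → Hodograph}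

theorem IsLocalParam.mapsTo (h : IsLocalParam S W r) : MapsTo r W S := by
  obtain ⟨O, -, e⟩ := h.isOpen_image W Subset.rfl h.isOpen
  intro w hw
  exact (e ▸ mem_image_of_mem r hw : r w ∈ S ∩ O).1

theorem IsLocalParam.hasFDerivAt (h : IsLocalParam S W r) {w : Plane} (hw : w ∈ W) :
    HasFDerivAt r (fderiv ℝ r w) w :=
  ((h.smooth.contDiffAt (h.isOpen.mem_nhds hw)).differentiableAt (by simp)).hasFDerivAt

/-- The change of parameters between two local parametrizations of a surface is smooth. -/
theorem IsLocalParam.exists_transition (h : IsLocalParam S W r) (h' : IsLocalParam S W' r')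
    {w w' : Plane} (hw : w ∈ W) (hw' : w' ∈ W') (e : r w = r' w') :
    ∃ (O : Set Plane) (τ : Plane → Plane), IsOpen O ∧ w ∈ O ∧ O ⊆ W ∧ ContDiffOn ℝ ∞ τ O ∧
      MapsTo τ O W' ∧ ∀ y ∈ O, r y = r' (τ y) := by
  -- Composing r' with a linear left inverse π of its derivative at w' gives a plane map F,
  -- invertible near w'; the transition map is F⁻¹ ∘ π ∘ r.
  obtain ⟨π₀, hπ₀⟩ := LinearMap.exists_leftInverse_of_injective
    (fderiv ℝ r' w' : Plane →ₗ[ℝ] Hodograph) (LinearMap.ker_eq_bot.2 (h'.immersion w' hw'))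
  set π : Hodograph →L[ℝ] Plane := LinearMap.toContinuousLinearMap π₀ with hπ
  set F : Plane → Plane := fun y => π (r' y) with hF
  have sF : ContDiffOn ℝ ∞ F W' := π.contDiff.comp_contDiffOn h'.smooth
  have dF : ∀ y ∈ W', HasFDerivAt F (π.comp (fderiv ℝ r' y)) y := fun y hy =>
    π.hasFDerivAt.comp y (h'.hasFDerivAt hy)
  have hd : ContDiffOn ℝ ∞ (fderiv ℝ F) W' := sF.fderiv_of_isOpen h'.isOpen (by simp)
  set D : Plane → ℝ := fun y => (fderiv ℝ F y (1, 0)).1 * (fderiv ℝ F y (0, 1)).2 -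
    (fderiv ℝ F y (1, 0)).2 * (fderiv ℝ F y (0, 1)).1 with hD
  have hDc : ContinuousOn D W' := by
    have c1 : ContinuousOn (fun y => fderiv ℝ F y (1, 0)) W' :=
      (hd.clm_apply contDiffOn_const).continuousOn
    have c2 : ContinuousOn (fun y => fderiv ℝ F y (0, 1)) W' :=
      (hd.clm_apply contDiffOn_const).continuousOn
    exact (c1.fst.mul c2.snd).sub (c1.snd.mul c2.fst)
  set Ω : Set Plane := W' ∩ D ⁻¹' {0}ᶜ with hΩ
  have hΩo : IsOpen Ω := hDc.isOpen_inter_preimage h'.isOpen isOpen_compl_singleton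
  have hwΩ : w' ∈ Ω := by
    refine ⟨hw', ?_⟩
    have hid : ∀ ξ, fderiv ℝ F w' ξ = ξ := fun ξ => by
      rw [(dF w' hw').fderiv]
      exact LinearMap.congr_fun hπ₀ ξ
    simp [hD, hid]
  have hinj : ∀ y ∈ Ω, Function.Injective (fderiv ℝ F y) := by
    intro y hy
    refine (injective_iff_map_eq_zero _).2 fun ξ hξ => ?_
    rw [clm_plane_apply] at hξ
    have k1 := congrArg Prod.fst hξ
    have k2 := congrArg Prod.snd hξ
    simp only [Prod.fst_add, Prod.snd_add, Prod.smul_fst, Prod.smul_snd, smul_eq_mul,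
      Prod.fst_zero, Prod.snd_zero] at k1 k2
    have hD0 : D y ≠ 0 := hy.2
    refine Prod.ext (mul_left_cancel₀ hD0 ?_) (mul_left_cancel₀ hD0 ?_)
    · simp only [hD, Prod.fst_zero, mul_zero]
      linear_combination (fderiv ℝ F y (0, 1)).2 * k1 - (fderiv ℝ F y (0, 1)).1 * k2
    · simp only [hD, Prod.snd_zero, mul_zero]
      linear_combination (fderiv ℝ F y (1, 0)).1 * k2 - (fderiv ℝ F y (1, 0)).2 * k1
  obtain ⟨g, hwg, hgΩ, hgF, hgs⟩ :=
    exists_openPartialHomeomorph hΩo (sF.mono inter_subset_left) hinj hwΩ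
  have hgW : g.source ⊆ W' := hgΩ.trans inter_subset_left
  -- Relative openness of the image guarantees that points of S near r w are reached by r' from the
  -- domain where F is inverted.
  obtain ⟨O', hO', eO'⟩ := h'.isOpen_image g.source hgW g.open_source
  set O : Set Plane := W ∩ r ⁻¹' O' with hO
  have hOo : IsOpen O := h.smooth.continuousOn.isOpen_inter_preimage h.isOpen hO'
  have key : ∀ y ∈ O, g.symm (π (r y)) ∈ g.source ∧ r y = r' (g.symm (π (r y))) ∧
      π (r y) ∈ g.target := by
    intro y hy
    have hmem : r y ∈ r' '' g.source := eO' ▸ ⟨h.mapsTo hy.1, hy.2⟩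
    obtain ⟨z, hz, ez⟩ := hmem
    have e1 : π (r y) = g z := by rw [hgF, hF, ← ez]
    rw [e1, g.left_inv hz]
    exact ⟨hz, ez.symm, g.map_source hz⟩
  refine ⟨O, fun y => g.symm (π (r y)), hOo, ⟨hw, ?_⟩, inter_subset_left, ?_, ?_, ?_⟩
  · have : r' w' ∈ S ∩ O' := eO' ▸ mem_image_of_mem r' hwg
    rw [mem_preimage, e]
    exact this.2
  · exact hgs.comp (π.contDiff.comp_contDiffOn (h.smooth.mono inter_subset_left))
      fun y hy => (key y hy).2.2
  · exact fun y hy => hgW (key y hy).1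
  · exact fun y hy => (key y hy).2.1

variable {U : Set Hodograph} {v : Fin 3 → Hodograph → ℝ} {l : Fin 3 → Hodograph → Hodograph}

theorem IsCharacteristicFrame.contDiffOn_pulledForm
    (h : IsCharacteristicFrame assocMatrix U v l) (hSU : S ⊆ U) (hr : IsLocalParam S W r)
    (i : Fin 3) : ContDiffOn ℝ ∞ (pulledForm l r i) W := by
  have hmaps : MapsTo r W U := hr.mapsTo.mono_right hSU
  have h1 : ContDiffOn ℝ ∞ (fun w => eigenform l i (r w)) W := by
    have : ContDiffOn ℝ ∞ (fun u => eigenform l i u) U := by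
      simp only [eigenform, covector]
      exact ContDiffOn.sum fun j _ =>
        (contDiffOn_pi.1 (h.smooth_covector i) j).smul contDiffOn_const
    exact this.comp hr.smooth hmaps
  exact h1.clm_comp (hr.smooth.fderiv_of_isOpen hr.isOpen (by simp))

theorem IsCharacteristicFrame.isConservationLaw_density (hU : IsOpen U)
    (h : IsCharacteristicFrame assocMatrix U v l) (i : Fin 3) :
    IsConservationLaw assocMatrix U (density v i) (flux v i) :=
  isConservationLaw_of_fderiv hU (h.contDiffOn_density i) (h.contDiffOn_flux i)
    fun _ hu ξ => h.fderiv_flux hU hu i ξ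

theorem IsSolution.pulledForm_apply (h : IsCharacteristicFrame assocMatrix U v l)
    (hmaps : MapsTo r W U) (hsol : IsSolution assocMatrix W r) {y : Plane} (hy : y ∈ W)
    (i : Fin 3) (ξ : Plane) :
    pulledForm l r i y ξ = pulledForm l r i y (1, 0) * (ξ.1 + v i (r y) * ξ.2) := by
  have h2 : pulledForm l r i y (0, 1) = v i (r y) * pulledForm l r i y (1, 0) := by
    simp only [pulledForm, ContinuousLinearMap.comp_apply]
    rw [hsol.2 y hy, h.eigenform_mulVec (hmaps hy)]
  rw [clm_plane_apply, h2]
  simp only [smul_eq_mul]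
  ring

/-- The conservation laws `(vⁱ⁺¹ - vⁱ⁺²)(dx + vⁱ dt)` form a closed triple on a solution. -/
theorem IsSolution.isClosedTriple (hU : IsOpen U) (h : IsCharacteristicFrame assocMatrix U v l)
    (hW : IsOpen W) (hmaps : MapsTo r W U) (hsol : IsSolution assocMatrix W r)
    (hne : ∀ y ∈ W, ∀ i, pulledForm l r i y ≠ 0) :
    IsClosedTriple (pulledForm l r) W fun i y =>
      density v i (r y) • ContinuousLinearMap.fst ℝ ℝ ℝ +
        flux v i (r y) • ContinuousLinearMap.snd ℝ ℝ ℝ := by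
  refine ⟨fun i => ?_, fun i y hy ξ ζ => ?_, fun i y hy => ?_, fun y hy => ?_⟩
  · exact (((h.contDiffOn_density i).comp hsol.1 hmaps).smul contDiffOn_const).add
      (((h.contDiffOn_flux i).comp hsol.1 hmaps).smul contDiffOn_const)
  · exact (h.isConservationLaw_density hU i).2.2 W r hW hmaps hsol y hy ξ ζ
  -- On a solution the pulled-back form is its value on ∂ₓ times dx + vⁱ dt, so it would vanish
  -- altogether.
  · have hx : pulledForm l r i y (1, 0) ≠ 0 := fun e => hne y hy i <| by
      refine ContinuousLinearMap.ext fun ξ => ?_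
      rw [hsol.pulledForm_apply h hmaps hy, e, zero_mul, _root_.zero_apply]
    refine ⟨density v i (r y) / pulledForm l r i y (1, 0),
      div_ne_zero (h.density_ne_zero (hmaps hy) i) hx, ?_⟩
    refine ContinuousLinearMap.ext fun ξ => ?_
    rw [_root_.smul_apply, hsol.pulledForm_apply h hmaps hy i ξ]
    simp [flux]
    field_simp
  · refine clm_plane_ext ?_ ?_
    · simp [density]
    · simp [flux, density]
      ring

theorem IsClosedTriple.comp {η η' β : Fin 3 → Plane → Plane →L[ℝ] ℝ} {O : Set Plane}
    {τ : Plane → Plane} (hW' : IsOpen W') (hβ : IsClosedTriple η' W' β) (hO : IsOpen O)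
    (hτ : ContDiffOn ℝ ∞ τ O) (hmaps : MapsTo τ O W')
    (hη : ∀ i, ∀ y ∈ O, η i y = (η' i (τ y)).comp (fderiv ℝ τ y)) :
    IsClosedTriple η O fun i y => (β i (τ y)).comp (fderiv ℝ τ y) := by
  refine ⟨fun i => ?_, fun i y hy ξ ζ => ?_, fun i y hy => ?_, fun y hy => ?_⟩
  · exact ((hβ.smooth i).comp hτ hmaps).clm_comp (hτ.fderiv_of_isOpen hO (by simp))
  · rw [extD_comp (((hβ.smooth i).contDiffAt (hW'.mem_nhds (hmaps hy))).differentiableAt (by simp))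
      ((hτ.contDiffAt (hO.mem_nhds hy)).of_le (WithTop.coe_le_coe.2 (le_top : (2 : ℕ∞) ≤ ⊤)))]
    exact hβ.closed i _ (hmaps hy) _ _
  · obtain ⟨k, hk, e⟩ := hβ.family i _ (hmaps hy)
    exact ⟨k, hk, by rw [hη i y hy, e, ContinuousLinearMap.smul_comp]⟩
  · rw [← ContinuousLinearMap.add_comp, ← ContinuousLinearMap.add_comp,
      hβ.sum_eq_zero _ (hmaps hy), ContinuousLinearMap.zero_comp]

theorem CutsThreeWeb.planeDet_ne_zero (hcut : CutsThreeWeb l S) (hr : IsLocalParam S W r)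
    {w : Plane} (hw : w ∈ W) {i j : Fin 3} (hij : i ≠ j) :
    planeDet (pulledForm l r i w) (pulledForm l r j w) ≠ 0 :=
  Hydrodynamic.planeDet_ne_zero (hcut W r hr w hw i j hij)

theorem CutsThreeWeb.pulledForm_ne_zero (hcut : CutsThreeWeb l S) (hr : IsLocalParam S W r)
    {w : Plane} (hw : w ∈ W) (i : Fin 3) : pulledForm l r i w ≠ 0 := fun e => by
  refine hcut.planeDet_ne_zero hr hw (Fin.add_one_ne i) ?_
  rw [e, planeDet_def]
  simp

/-- The closed triple lives on the parametrization by a solution and is carried to an arbitrary one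
by the transition map. -/
theorem IsHydrodynamicSurface.hasHexagonalWeb (hU : IsOpen U)
    (h : IsCharacteristicFrame assocMatrix U v l) (hSU : S ⊆ U) (hcut : CutsThreeWeb l S)
    (hS : IsHydrodynamicSurface assocMatrix S) : HasHexagonalWeb l S := by
  intro W r hr
  refine isHexagonalWeb_of_closedTriple hr.isOpen (h.contDiffOn_pulledForm hSU hr)
    (fun w hw => hcut.planeDet_ne_zero hr hw (by decide))
    (fun w hw => hcut.planeDet_ne_zero hr hw (by decide))
    (fun w hw => hcut.planeDet_ne_zero hr hw (by decide)) fun w hw => ?_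
  obtain ⟨W', r', hr', ⟨w', hw', e⟩, hsol⟩ := hS (r w) (hr.mapsTo hw)
  obtain ⟨O, τ, hO, hwO, hOW, hτ, hmaps, hrτ⟩ := hr.exists_transition hr' hw hw' e.symm
  have hβ := IsSolution.isClosedTriple hU h hr'.isOpen (hr'.mapsTo.mono_right hSU) hsol
    fun y hy i => hcut.pulledForm_ne_zero hr' hy i
  refine ⟨O, hO, hwO, hOW, _, hβ.comp hr'.isOpen hO hτ hmaps fun i y hy => ?_⟩
  have hτy : HasFDerivAt τ (fderiv ℝ τ y) y :=
    ((hτ.contDiffAt (hO.mem_nhds hy)).differentiableAt (by simp)).hasFDerivAt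
  have hd : HasFDerivAt r ((fderiv ℝ r' (τ y)).comp (fderiv ℝ τ y)) y :=
    ((hr'.hasFDerivAt (hmaps hy)).comp y hτy).congr_of_eventuallyEq <| by
      filter_upwards [hO.mem_nhds hy] with z hz using hrτ z hz
  rw [pulledForm, pulledForm, hd.fderiv, hrτ y hy, ContinuousLinearMap.comp_assoc]

end Surfaces

/-! ### From hexagonal webs to solutions. -/

section Surfaces

variable {S : Set Hodograph} {W O : Set Plane} {r : Plane → Hodograph}
  {U : Set Hodograph} {v : Fin 3 → Hodograph → ℝ} {l : Fin 3 → Hodograph → Hodograph}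
  {β : Fin 3 → Plane → Plane →L[ℝ] ℝ}

/-- A closed triple of a characteristic web is of the form
`βᵢ = (vⁱ⁺¹ - vⁱ⁺²)(θ + vⁱ ψ)`. -/
theorem IsClosedTriple.exists_coframe (h : IsCharacteristicFrame assocMatrix U v l)
    (hmaps : MapsTo r O U) (hr : ContDiffOn ℝ ∞ r O) (hβ : IsClosedTriple (pulledForm l r) O β) :
    ∃ θ ψ : Plane → Plane →L[ℝ] ℝ, ContDiffOn ℝ ∞ θ O ∧ ContDiffOn ℝ ∞ ψ O ∧
      ∀ i, ∀ y ∈ O, β i y = density v i (r y) • θ y + flux v i (r y) • ψ y := by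
  have sv : ∀ i, ContDiffOn ℝ ∞ (fun y => v i (r y)) O := fun i =>
    (h.smooth_velocity i).comp hr hmaps
  have sd : ∀ i, ContDiffOn ℝ ∞ (fun y => density v i (r y)) O := fun i =>
    (h.contDiffOn_density i).comp hr hmaps
  have hd : ∀ i, ∀ y ∈ O, density v i (r y) ≠ 0 := fun i y hy => h.density_ne_zero (hmaps hy) i
  have sinv : ∀ i, ContDiffOn ℝ ∞ (fun y => (density v i (r y))⁻¹) O := fun i =>
    (sd i).inv (hd i)
  -- Dividing β₀ and β₁ by their densities gives two linear equations for θ and ψ, with determinant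
  -- ±(v⁰ − v¹). The equation for β₂ follows because the densities and the fluxes each sum to zero.
  set ψ : Plane → Plane →L[ℝ] ℝ := fun y => (density v 2 (r y))⁻¹ •
    ((density v 0 (r y))⁻¹ • β 0 y - (density v 1 (r y))⁻¹ • β 1 y) with hψ
  set θ : Plane → Plane →L[ℝ] ℝ := fun y =>
    (density v 0 (r y))⁻¹ • β 0 y - v 0 (r y) • ψ y with hθ
  have sψ : ContDiffOn ℝ ∞ ψ O :=
    (sinv 2).smul (((sinv 0).smul (hβ.smooth 0)).sub ((sinv 1).smul (hβ.smooth 1)))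
  have sθ : ContDiffOn ℝ ∞ θ O := ((sinv 0).smul (hβ.smooth 0)).sub ((sv 0).smul sψ)
  refine ⟨θ, ψ, sθ, sψ, fun i y hy => ?_⟩
  have d0 := hd 0 y hy
  have d1 := hd 1 y hy
  have d2 := hd 2 y hy
  have e2 : β 2 y = -(β 0 y + β 1 y) := (neg_eq_of_add_eq_zero_right (hβ.sum_eq_zero y hy)).symm
  have k0 : density v 0 (r y) = v 1 (r y) - v 2 (r y) := rfl
  have k1 : density v 1 (r y) = v 2 (r y) - v 0 (r y) := rfl
  have k2 : density v 2 (r y) = v 0 (r y) - v 1 (r y) := rfl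
  refine ContinuousLinearMap.ext fun ξ => ?_
  fin_cases i
  · simp only [hθ, hψ, flux, Fin.zero_eta, _root_.add_apply, _root_.smul_apply,
      _root_.sub_apply, smul_eq_mul]
    field_simp
    ring
  · simp only [hθ, hψ, flux, Fin.mk_one, _root_.add_apply, _root_.smul_apply,
      _root_.sub_apply, smul_eq_mul]
    field_simp
    rw [k0, k1, k2]
    ring
  · simp only [e2, hθ, hψ, flux, Fin.reduceFinMk, _root_.add_apply,
      _root_.smul_apply, _root_.sub_apply, _root_.neg_apply, smul_eq_mul]
    field_simp
    rw [k0, k1, k2]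
    ring

variable {θ ψ : Plane → Plane →L[ℝ] ℝ}

theorem IsClosedTriple.pulledForm_eq (h : IsCharacteristicFrame assocMatrix U v l)
    (hmaps : MapsTo r O U) (hβ : IsClosedTriple (pulledForm l r) O β)
    (hβθ : ∀ i, ∀ y ∈ O, β i y = density v i (r y) • θ y + flux v i (r y) • ψ y) (i : Fin 3)
    {y : Plane} (hy : y ∈ O) :
    ∃ m : ℝ, m ≠ 0 ∧ pulledForm l r i y = m • (θ y + v i (r y) • ψ y) := by
  obtain ⟨k, hk, e⟩ := hβ.family i y hy
  refine ⟨k⁻¹ * density v i (r y),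
    mul_ne_zero (inv_ne_zero hk) (h.density_ne_zero (hmaps hy) i), ?_⟩
  rw [mul_smul, smul_add, smul_smul, ← flux, ← hβθ i y hy, e, smul_smul, inv_mul_cancel₀ hk,
    one_smul]

/-- The vectors ξ, ζ act as ∂ₓ, ∂ₜ up to a common scale, and ωⁱ ∝ θ + vⁱψ turns the claim into an
identity for each eigenform. Leaving the scale free makes it usable before θ and ψ are known to be
closed. -/
theorem IsClosedTriple.fderiv_eq_mulVec (h : IsCharacteristicFrame assocMatrix U v l)
    (hmaps : MapsTo r O U) (hβ : IsClosedTriple (pulledForm l r) O β)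
    (hβθ : ∀ i, ∀ y ∈ O, β i y = density v i (r y) • θ y + flux v i (r y) • ψ y)
    {y : Plane} (hy : y ∈ O) {ξ ζ : Plane} (h1 : ψ y ξ = 0) (h2 : θ y ζ = 0)
    (h3 : ψ y ζ = θ y ξ) : fderiv ℝ r y ζ = assocMatrix (r y) *ᵥ fderiv ℝ r y ξ := by
  refine h.eq_of_eigenform_eq (hmaps hy) fun i => ?_
  rw [h.eigenform_mulVec (hmaps hy)]
  change pulledForm l r i y ζ = v i (r y) * pulledForm l r i y ξ
  obtain ⟨m, -, e⟩ := hβ.pulledForm_eq h hmaps hβθ i hy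
  rw [e]
  simp only [_root_.smul_apply, _root_.add_apply, smul_eq_mul, h1, h2, h3]
  ring

/-- In dβᵢ = 0 the terms d(density) ∧ θ + d(flux) ∧ ψ cancel by `fderiv_flux`, since r satisfies the
system relative to the coframe. What remains is dθ + vⁱ dψ = 0 for each i, and two distinct
velocities suffice. -/
theorem IsClosedTriple.coframe_closed (hU : IsOpen U)
    (h : IsCharacteristicFrame assocMatrix U v l) (hO : IsOpen O)
    (hmaps : MapsTo r O U) (hr : ContDiffOn ℝ ∞ r O) (hβ : IsClosedTriple (pulledForm l r) O β)
    (hθ : ContDiffOn ℝ ∞ θ O) (hψ : ContDiffOn ℝ ∞ ψ O)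
    (hβθ : ∀ i, ∀ y ∈ O, β i y = density v i (r y) • θ y + flux v i (r y) • ψ y)
    {y : Plane} (hy : y ∈ O) (ξ ζ : Plane) : extD θ y ξ ζ = 0 ∧ extD ψ y ξ ζ = 0 := by
  have hdiff : ∀ {F : Type} [NormedAddCommGroup F] [NormedSpace ℝ F] {f : Plane → F},
      ContDiffOn ℝ ∞ f O → DifferentiableAt ℝ f y := fun hf =>
    (hf.contDiffAt (hO.mem_nhds hy)).differentiableAt (by simp)
  have key : ∀ i, extD θ y (1, 0) (0, 1) + v i (r y) * extD ψ y (1, 0) (0, 1) = 0 := by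
    intro i
    have sd : ContDiffOn ℝ ∞ (fun y => density v i (r y)) O :=
      (h.contDiffOn_density i).comp hr hmaps
    have sf : ContDiffOn ℝ ∞ (fun y => flux v i (r y)) O := (h.contDiffOn_flux i).comp hr hmaps
    have dr : HasFDerivAt r (fderiv ℝ r y) y := (hdiff hr).hasFDerivAt
    have dd : fderiv ℝ (fun y => density v i (r y)) y =
        (fderiv ℝ (density v i) (r y)).comp (fderiv ℝ r y) :=
      ((((h.contDiffOn_density i).contDiffAt (hU.mem_nhds (hmaps hy))).differentiableAt
        (by simp)).hasFDerivAt.comp y dr).fderiv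
    have df : fderiv ℝ (fun y => flux v i (r y)) y =
        (fderiv ℝ (flux v i) (r y)).comp (fderiv ℝ r y) :=
      ((((h.contDiffOn_flux i).contDiffAt (hU.mem_nhds (hmaps hy))).differentiableAt
        (by simp)).hasFDerivAt.comp y dr).fderiv
    have e : extD (fun y => density v i (r y) • θ y + flux v i (r y) • ψ y) y (1, 0) (0, 1) = 0 :=
      (extD_congr (by filter_upwards [hO.mem_nhds hy] with z hz using (hβθ i z hz).symm)
        _ _).trans (hβ.closed i y hy (1, 0) (0, 1))
    rw [extD_add (α := fun y => density v i (r y) • θ y) (β := fun y => flux v i (r y) • ψ y)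
      (hdiff (sd.smul hθ)) (hdiff (sf.smul hψ)), extD_smul (hdiff sd) (hdiff hθ),
      extD_smul (hdiff sf) (hdiff hψ), dd, df] at e
    -- The dual frame of (θ, ψ) multiplied by its determinant, which avoids division.
    have hm := hβ.fderiv_eq_mulVec h hmaps hβθ hy (ξ := (ψ y (0, 1), -ψ y (1, 0)))
      (ζ := (-θ y (0, 1), θ y (1, 0)))
      (by rw [clm_plane_apply]; simp only [smul_eq_mul]; ring)
      (by rw [clm_plane_apply]; simp only [smul_eq_mul]; ring)
      (by rw [clm_plane_apply (ψ y) (-θ y (0, 1), θ y (1, 0)),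
            clm_plane_apply (θ y) (ψ y (0, 1), -ψ y (1, 0))]
          simp only [smul_eq_mul]; ring)
    have hl := h.fderiv_flux hU (hmaps hy) i (fderiv ℝ r y (ψ y (0, 1), -ψ y (1, 0)))
    rw [← hm, clm_plane_apply (fderiv ℝ r y) (ψ y (0, 1), -ψ y (1, 0)),
      clm_plane_apply (fderiv ℝ r y) (-θ y (0, 1), θ y (1, 0))] at hl
    simp only [map_add, map_smul, smul_eq_mul] at hl
    refine mul_left_cancel₀ (h.density_ne_zero (hmaps hy) i) ?_
    simp only [wedge, ContinuousLinearMap.comp_apply, flux] at e hl ⊢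
    linear_combination e - hl
  have hne : v 0 (r y) - v 1 (r y) ≠ 0 := sub_ne_zero.2 (h.ne (hmaps hy) (by decide))
  have e1 : extD ψ y (1, 0) (0, 1) = 0 :=
    mul_left_cancel₀ hne (by linear_combination key 0 - key 1)
  have e2 : extD θ y (1, 0) (0, 1) = 0 := by simpa [e1] using key 0
  rw [extD_plane, extD_plane ψ, e1, e2]
  simp

theorem IsLocalParam.comp_symm (hr : IsLocalParam S W r) (e : OpenPartialHomeomorph Plane Plane)
    (hsource : e.source ⊆ W) (hs : ContDiffOn ℝ ∞ e.symm e.target)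
    (hinj : ∀ z ∈ e.target, Function.Injective (fderiv ℝ e.symm z)) :
    IsLocalParam S e.target (fun z => r (e.symm z)) := by
  have hm : MapsTo e.symm e.target W := fun z hz => hsource (e.map_target hz)
  refine ⟨e.open_target, hr.smooth.comp hs hm, fun z hz => ?_, fun z hz z' hz' h => ?_,
    fun W' hW' hW'o => ?_⟩
  · have hd : HasFDerivAt e.symm (fderiv ℝ e.symm z) z :=
      ((hs.contDiffAt (e.open_target.mem_nhds hz)).differentiableAt (by simp)).hasFDerivAt
    have : fderiv ℝ (fun z => r (e.symm z)) z = _ := ((hr.hasFDerivAt (hm hz)).comp z hd).fderiv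
    rw [this]
    exact (hr.immersion _ (hm hz)).comp (hinj z hz)
  · exact e.symm.injOn hz hz' (hr.injOn (hm hz) (hm hz') h)
  · have := hr.isOpen_image (e.symm '' W') (by rintro _ ⟨z, hz, rfl⟩; exact hm (hW' hz))
      (e.symm.isOpen_image_of_subset_source hW'o hW')
    rwa [image_image] at this

/-- A closed triple of the characteristic web of a surface yields a local parametrization of the
surface by a solution. -/
theorem IsClosedTriple.exists_solution (hU : IsOpen U)
    (h : IsCharacteristicFrame assocMatrix U v l) (hSU : S ⊆ U) (hr : IsLocalParam S W r)
    (hO : IsOpen O) (hOW : O ⊆ W) (hβ : IsClosedTriple (pulledForm l r) O β) {w : Plane} (hw : w ∈ O) :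
    ∃ (T : Set Plane) (u : Plane → Hodograph),
      IsLocalParam S T u ∧ r w ∈ u '' T ∧ IsSolution assocMatrix T u := by
  have hmaps : MapsTo r O U := (hr.mapsTo.mono_right hSU).mono_left hOW
  obtain ⟨θ, ψ, sθ, sψ, hβθ⟩ := hβ.exists_coframe h hmaps (hr.smooth.mono hOW)
  obtain ⟨ε, hε, hball⟩ := Metric.isOpen_iff.1 hO w hw
  have hcl := fun y (hy : y ∈ O) =>
    hβ.coframe_closed hU h hO hmaps (hr.smooth.mono hOW) sθ sψ hβθ hy
  obtain ⟨x, sx, hx⟩ := exists_primitive Metric.isOpen_ball (convex_ball w ε) (sθ.mono hball)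
    fun y hy ξ ζ => (hcl y (hball hy) ξ ζ).1
  obtain ⟨t, st, ht⟩ := exists_primitive Metric.isOpen_ball (convex_ball w ε) (sψ.mono hball)
    fun y hy ξ ζ => (hcl y (hball hy) ξ ζ).2
  set F : Plane → Plane := fun y => (x y, t y) with hF
  have dF : ∀ y ∈ Metric.ball w ε, HasFDerivAt F ((θ y).prod (ψ y)) y := fun y hy =>
    (hx y hy).prodMk (ht y hy)
  -- A vector killed by θ and ψ is killed by all pulled-back eigenforms, hence by the derivative of
  -- r, which is injective.
  have hinj : ∀ y ∈ Metric.ball w ε, Function.Injective (fderiv ℝ F y) := by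
    intro y hy
    have hyO := hball hy
    rw [(dF y hy).fderiv]
    refine (injective_iff_map_eq_zero _).2 fun ξ hξ => ?_
    have k1 : θ y ξ = 0 := congrArg Prod.fst hξ
    have k2 : ψ y ξ = 0 := congrArg Prod.snd hξ
    have hz : ∀ i, pulledForm l r i y ξ = 0 := fun i => by
      obtain ⟨m, -, e⟩ := hβ.pulledForm_eq h hmaps hβθ i hyO
      rw [e]
      simp [k1, k2]
    refine hr.immersion y (hOW hyO) (h.eq_of_eigenform_eq (hmaps hyO) fun i => ?_)
    rw [map_zero, map_zero]
    exact hz i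
  obtain ⟨e, hwe, heB, heF, hes⟩ := exists_openPartialHomeomorph Metric.isOpen_ball
    (sx.prodMk st) hinj (Metric.mem_ball_self hε)
  have heO : e.source ⊆ O := heB.trans hball
  have hds : ∀ z ∈ e.target, HasFDerivAt e.symm (fderiv ℝ e.symm z) z := fun z hz =>
    ((hes.contDiffAt (e.open_target.mem_nhds hz)).differentiableAt (by simp)).hasFDerivAt
  -- In the coordinates x, t the forms θ and ψ become dx and dt, so ∂ₓ, ∂ₜ satisfy the conditions of
  -- `fderiv_eq_mulVec`.
  have hid : ∀ z ∈ e.target, ∀ ζ, θ (e.symm z) (fderiv ℝ e.symm z ζ) = ζ.1 ∧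
      ψ (e.symm z) (fderiv ℝ e.symm z ζ) = ζ.2 := by
    intro z hz ζ
    have h1 := (dF _ (heB (e.map_target hz))).comp z (hds z hz)
    have h2 : HasFDerivAt (F ∘ e.symm) (ContinuousLinearMap.id ℝ Plane) z :=
      (hasFDerivAt_id z).congr_of_eventuallyEq <| by
        filter_upwards [e.open_target.mem_nhds hz] with z' hz'
        exact (heF _).symm.trans (e.right_inv hz')
    have h3 := DFunLike.congr_fun (h1.unique h2) ζ
    exact ⟨congrArg Prod.fst h3, congrArg Prod.snd h3⟩
  have hparam := hr.comp_symm e (heO.trans hOW) hes fun z hz =>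
    (injective_iff_map_eq_zero _).2 fun ζ hζ => by
      obtain ⟨e1, e2⟩ := hid z hz ζ
      rw [hζ, map_zero] at e1 e2
      exact Prod.ext e1.symm e2.symm
  refine ⟨e.target, fun z => r (e.symm z), hparam,
    ⟨e w, e.map_source hwe, by simp only [e.left_inv hwe]⟩, hparam.smooth, fun z hz => ?_⟩
  have hy : e.symm z ∈ O := heO (e.map_target hz)
  have hd : fderiv ℝ (fun z => r (e.symm z)) z = _ :=
    ((hr.hasFDerivAt (hOW hy)).comp z (hds z hz)).fderiv
  rw [hd]
  refine hβ.fderiv_eq_mulVec h hmaps hβθ hy (hid z hz _).2 (hid z hz _).1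
    ((hid z hz (0, 1)).2.trans (hid z hz (1, 0)).1.symm)

theorem HasHexagonalWeb.isHydrodynamicSurface (hU : IsOpen U)
    (h : IsCharacteristicFrame assocMatrix U v l) (hSU : S ⊆ U) (hS : IsSmoothSurface S)
    (hhex : HasHexagonalWeb l S) :
    IsHydrodynamicSurface assocMatrix S := by
  intro p hp
  obtain ⟨W, r, hr, w, hw, rfl⟩ := hS p hp
  obtain ⟨O, hO, hwO, hOW, β, hβ⟩ := (hhex W r hr).exists_closedTriple hr.isOpen hw
  exact hβ.exists_solution hU h hSU hr hO hOW hwO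

end Surfaces

end Hydrodynamic

/-! ### Assembly of the four statements. -/

theorem mainTheorem3 :
    (∀ (U : Set Hodograph) (v : Fin 3 → Hodograph → ℝ) (l : Fin 3 → Hodograph → Hodograph),
      IsOpen U → IsCharacteristicFrame assocMatrix U v l →
      -- the reciprocal invariants vanish
      (∀ u ∈ U, (∀ i, Omega_i v l i u = 0) ∧ Omega v l u = 0 ∧
        ∀ ξ η : Hodograph, extD (Omega v l) u ξ η = 0) ∧
      -- reciprocal equivalence to a system with constant characteristic velocities
      (∃ B A N M : Hodograph → ℝ, IsReciprocalTransformation assocMatrix U B A N M ∧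
        ∃ k : Fin 3 → ℝ,
          IsCharacteristicFrame (reciprocalMatrix assocMatrix B A N M) U (fun i _ => k i) l) ∧
      -- hydrodynamic surfaces are the surfaces with hexagonal characteristic web
      (∀ S : Set Hodograph, S ⊆ U → IsSmoothSurface S → CutsThreeWeb l S →
        (IsHydrodynamicSurface assocMatrix S ↔ HasHexagonalWeb l S)) ∧
      -- the characteristic distributions come from the twisted cubic
      (∀ u ∈ U,
        ({τ | u ∈ oscPlane ℝ τ} = range fun i => v i u) ∧
        {τ | u ∈ oscPlane ℝ τ}.ncard = 3 ∧
        ({ℓ | ℓ ∈ cubicCongruence ℝ ∧ u ∈ ℓ} = range fun i => tangentialLine ℝ u (v i u)) ∧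
        {ℓ | ℓ ∈ cubicCongruence ℝ ∧ u ∈ ℓ}.ncard = 3 ∧
        ∀ i, (LinearMap.ker (eigenform l i u : Hodograph →ₗ[ℝ] ℝ) =
            Submodule.span ℝ ((fun j => deriv (cubic ℝ) (v j u)) '' {i}ᶜ)) ∧
          (∀ I : Set ℝ, I.OrdConnected → 0 ∈ I →
            (∀ s ∈ I, u + s • deriv (cubic ℝ) (v i u) ∈ U) →
            IsRarefactionCurve assocMatrix U (v i) I
              fun s => u + s • deriv (cubic ℝ) (v i u)) ∧
          (∀ (I : Set ℝ) (c : ℝ → Hodograph), I.OrdConnected →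
            IsRarefactionCurve assocMatrix U (v i) I c → ∀ s₀ ∈ I, c s₀ = u →
            ∀ s ∈ I, c s ∈ tangentialLine ℝ u (v i u)))) ∧
    HasOrder (cubicCongruence ℂ) 3 := by
  refine ⟨fun U v l hU h => ⟨fun u hu => ⟨h.Omega_i_eq_zero hU hu, h.Omega_eq_zero hU hu,
    h.extD_Omega_eq_zero hU hu⟩, h.exists_reciprocal hU, fun S hSU hS hcut =>
    ⟨fun hyd => hyd.hasHexagonalWeb hU h hSU hcut,
      fun hhex => hhex.isHydrodynamicSurface hU h hSU hS⟩, fun u hu => ?_⟩,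
    hasOrder_cubicCongruence⟩
  refine ⟨h.setOf_mem_oscPlane hu, h.ncard_oscPlane hu, ?_, ?_, fun i =>
    ⟨h.ker_eigenform hu i, fun I hI h0 hmem => h.isRarefactionCurve_line i hI h0 hmem, ?_⟩⟩
  · rw [setOf_mem_cubicCongruence, h.setOf_mem_oscPlane hu, ← range_comp]
    rfl
  · rw [setOf_mem_cubicCongruence, ncard_image_of_injective _ (tangentialLine_injective u),
      h.ncard_oscPlane hu]
  · rintro I c hI hc s₀ hs₀ rfl s hs
    exact hc.mem_tangentialLine hU h hI hs₀ hs
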